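/- Consider a two-party Bell scenario with $m_A$ inputs for Alice, $m_B$ inputs for Bob, $d_{A,i_A}$ outputs for Alice's input $i_A$ and $d_{B,i_B}$ outputs for Bob's input $i_B$, where all these numbers are arbitrary. A box is a vector $P=(P(o_A,o_B|i_A,i_B))\in\mathbb R^n$ with $n=\left(\sum_{i_A}d_{A,i_A}\right)\left(\sum_{i_B}d_{B,i_B}\right)$. The no-signalling polytope $\mathbf{NS}$ is the set of boxes that are non-negative, normalized ($\sum_{o_A,o_B}P(o_A,o_B|i_A,i_B)=1$ for all $i_A,i_B$) and no-signalling ($\sum_{o_A}P(o_A,o_B|i_A,i_B)$ does not depend on $i_A$ and $\sum_{o_B}P(o_A,o_B|i_A,i_B)$ does not depend on $i_B$). The classical polytope $\mathbf C$ is the convex hull of the boxes in $\mathbf{NS}$ with all entries in $\{0,1\}$. The almost quantum set $\mathbf Q_{1+AB}$ is the set of boxes $P\in\mathbf{NS}$ for which there is a complex Hermitian positive semidefinite matrix $\Gamma$, with rows and columns indexed by the formal operators $\mathbb 1$ and $E^A_{i_A,o_A}E^B_{i_B,o_B}$ (for all $i_A,o_A,i_B,o_B$), such that $\Gamma_{\mathbb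 1,\mathbb 1}=1$, $\Gamma_{\mathbb 1,E^A_{i_A,o_A}E^B_{i_B,o_B}}=P(o_A,o_B|i_A,i_B)$, $\Gamma_{Q,R}=\Gamma_{S,T}$ whenever $Q^\dagger R=S^\dagger T$, and $\Gamma_{Q,R}=0$ whenever $Q^\dagger R=0$. Here the products are reduced by the rules that the $E^A_{i_A,o_A}$ and $E^B_{i_B,o_B}$ are Hermitian idempotents, that those of the same party with the same input and different outputs have product $0$, and that those of different parties commute. For a polytope $K$, an inequality $\sum_{o_A,o_B,i_A,i_B} B(o_A,o_B,i_A,i_B)P(o_A,o_B|i_A,i_B)\le\omega$ supports a facet of $K$ if it holds for all $P\in K$ and the set of $P\in K$ that attain equality is non-empty, different from $K$, and has dimension $\dim K-1$. A facet Bell inequality is an inequality that supports a facet of $\mathbf C$ and does not support a facet of $\mathbf{NS}$ (this excludes the trivial facets such as $P(o_A,o_B|i_A,i_B)\ge 0$). **Theorem.** In every two-party Bell scenario, irrespective of the numbers of inputs and outputs, every facet Bell inequality $$\sum_{o_A,o_B,i_A,i_B} q(i_A,i_B)\,V(o_A,o_B,i_A,i_B)\,P(o_A,o_B|i_A,i_B)\le\omega_c$$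 (with arbitrary real $q$ and $V$) is violated by almost quantum correlations. That is, $\omega_c$ is the maximum of the left-hand side over $\mathbf C$ (the classical value), the supremum $\omega_{\tilde q}$ of the left-hand side over $\mathbf Q_{1+AB}$ (the almost quantum value) is finite, and $\omega_{\tilde q}>\omega_c$. -/

import Mathlib

open scoped ComplexOrder

/-! Two-party Bell scenarios, their classical, no-signalling and almost quantum sets.

A scenario is given by numbers of inputs `mA mB : ℕ` and, for each input, a number of outputs
`dA : Fin mA → ℕ`, `dB : Fin mB → ℕ`. -/

/-- A pair (input, output) of one party; it labels the projector `E_{input, output}`. -/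
abbrev LocalEvent {m : ℕ} (d : Fin m → ℕ) : Type := Σ i : Fin m, Fin (d i)

/-- An event `(o_A, o_B | i_A, i_B)`, written `(⟨i_A, o_A⟩, ⟨i_B, o_B⟩)`. -/
abbrev BellEvent {mA mB : ℕ} (dA : Fin mA → ℕ) (dB : Fin mB → ℕ) : Type :=
  LocalEvent dA × LocalEvent dB

/-- Boxes: vectors `P` in `ℝ^n` with entries `P(o_A, o_B | i_A, i_B)`. -/
abbrev Box {mA mB : ℕ} (dA : Fin mA → ℕ) (dB : Fin mB → ℕ) : Type := BellEvent dA dB → ℝ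

/-- The no-signalling polytope: non-negative, normalized, no-signalling boxes. -/
structure IsNoSignalling {mA mB : ℕ} {dA : Fin mA → ℕ} {dB : Fin mB → ℕ}
    (P : Box dA dB) : Prop where
  nonneg : ∀ e, 0 ≤ P e
  normalized : ∀ (x : Fin mA) (y : Fin mB),
    ∑ a : Fin (dA x), ∑ b : Fin (dB y), P (⟨x, a⟩, ⟨y, b⟩) = 1
  noSignalling_to_Bob : ∀ (x x' : Fin mA) (y : Fin mB) (b : Fin (dB y)),
    ∑ a : Fin (dA x), P (⟨x, a⟩, ⟨y, b⟩) = ∑ a' : Fin (dA x'), P (⟨x', a'⟩, ⟨y, b⟩)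
  noSignalling_to_Alice : ∀ (y y' : Fin mB) (x : Fin mA) (a : Fin (dA x)),
    ∑ b : Fin (dB y), P (⟨x, a⟩, ⟨y, b⟩) = ∑ b' : Fin (dB y'), P (⟨x, a⟩, ⟨y', b'⟩)

def noSignallingPolytope {mA mB : ℕ} (dA : Fin mA → ℕ) (dB : Fin mB → ℕ) : Set (Box dA dB) :=
  {P | IsNoSignalling P}

/-- Local deterministic boxes: no-signalling boxes with entries in `{0, 1}`. -/
def localDeterministicBoxes {mA mB : ℕ} (dA : Fin mA → ℕ) (dB : Fin mB → ℕ) :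
    Set (Box dA dB) :=
  {P | IsNoSignalling P ∧ ∀ e, P e = 0 ∨ P e = 1}

/-- The classical (Bell, local) polytope. -/
def classicalPolytope {mA mB : ℕ} (dA : Fin mA → ℕ) (dB : Fin mB → ℕ) : Set (Box dA dB) :=
  convexHull ℝ (localDeterministicBoxes dA dB)

/-- The index set `{1} ∪ {E^A_{i_A,o_A} E^B_{i_B,o_B}}` of the level `1 + AB`;
`none` is the identity operator. -/
abbrev OpIndex {mA mB : ℕ} (dA : Fin mA → ℕ) (dB : Fin mB → ℕ) : Type :=
  Option (BellEvent dA dB)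

/-- Product of two operators of one party, each of which is the identity (`none`) or a projector
(`some u`). The result is `some w` for the reduced word `w` in the projectors (`[]` being the
identity), or `none` if the product is the zero operator, which happens for
different outputs of the same input. -/
def localProduct {m : ℕ} {d : Fin m → ℕ} :
    Option (LocalEvent d) → Option (LocalEvent d) → Option (List (LocalEvent d))
  | none, none => some []
  | none, some v => some [v]
  | some u, none => some [u]
  | some u, some v => if u = v then some [u] else if u.1 = v.1 then none else some [u, v]

/-- The operator `Q† R`. Since the projectors are Hermitian and those of different parties commute,
`(E^A E^B)† (E'^A E'^B) = (E^A E'^A) (E^B E'^B)`; it is recorded as the pair of reduced words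
of Alice and Bob, and as `none` if it is the zero operator. -/
def daggerProduct {mA mB : ℕ} {dA : Fin mA → ℕ} {dB : Fin mB → ℕ} (Q R : OpIndex dA dB) :
    Option (List (LocalEvent dA) × List (LocalEvent dB)) :=
  match localProduct (Q.map Prod.fst) (R.map Prod.fst),
      localProduct (Q.map Prod.snd) (R.map Prod.snd) with
  | some u, some v => some (u, v)
  | _, _ => none

/-- `Γ` is a certificate of level `1 + AB` for the box `P`. -/
structure IsCertificate {mA mB : ℕ} {dA : Fin mA → ℕ} {dB : Fin mB → ℕ}
    (Γ : Matrix (OpIndex dA dB) (OpIndex dA dB) ℂ) (P : Box dA dB) : Prop where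
  posSemidef : Γ.PosSemidef
  one_one : Γ none none = 1
  eq_of_product_eq : ∀ Q R S T, daggerProduct Q R = daggerProduct S T → Γ Q R = Γ S T
  eq_zero_of_product_eq_zero : ∀ Q R, daggerProduct Q R = none → Γ Q R = 0
  prob : ∀ e, Γ none (some e) = (P e : ℂ)

/-- The almost quantum set `Q_{1+AB}`. Completeness of the measurements enters through the
normalization and no-signalling of `P`. -/
def almostQuantumSet {mA mB : ℕ} (dA : Fin mA → ℕ) (dB : Fin mB → ℕ) : Set (Box dA dB) :=
  {P | IsNoSignalling P ∧ ∃ Γ, IsCertificate Γ P}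

/-- The Bell expression `∑ B(o_A,o_B,i_A,i_B) P(o_A,o_B|i_A,i_B)`. -/
def bellValue {mA mB : ℕ} {dA : Fin mA → ℕ} {dB : Fin mB → ℕ} (B P : Box dA dB) : ℝ :=
  ∑ e, B e * P e

/-- The dimension of (the affine hull of) a non-empty set of boxes. -/
noncomputable def affineDim {mA mB : ℕ} {dA : Fin mA → ℕ} {dB : Fin mB → ℕ}
    (K : Set (Box dA dB)) : ℕ :=
  Module.finrank ℝ (affineSpan ℝ K).direction

/-- The face of `K` supported by the inequality `B · P ≤ ω`. -/
def face {mA mB : ℕ} {dA : Fin mA → ℕ} {dB : Fin mB → ℕ} (K : Set (Box dA dB))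
    (B : Box dA dB) (ω : ℝ) : Set (Box dA dB) :=
  {P | P ∈ K ∧ bellValue B P = ω}

/-- The inequality `B · P ≤ ω` is valid on the polytope `K` and supports a facet of it, i.e. a
proper non-empty face of dimension `dim K - 1`. -/
structure SupportsFacet {mA mB : ℕ} {dA : Fin mA → ℕ} {dB : Fin mB → ℕ}
    (K : Set (Box dA dB)) (B : Box dA dB) (ω : ℝ) : Prop where
  valid : ∀ P ∈ K, bellValue B P ≤ ω
  nonempty : (face K B ω).Nonempty
  proper : face K B ω ≠ K
  dim : affineDim (face K B ω) + 1 = affineDim K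

/-- Facet (tight) Bell inequalities: facets of the classical polytope that are not also facets of
the no-signalling polytope. -/
structure IsFacetBellInequality {mA mB : ℕ} {dA : Fin mA → ℕ} {dB : Fin mB → ℕ}
    (B : Box dA dB) (ω : ℝ) : Prop where
  facet : SupportsFacet (classicalPolytope dA dB) B ω
  nontrivial : ¬ SupportsFacet (noSignallingPolytope dA dB) B ω

/-- `ω_c`, the maximum of the Bell expression over the classical polytope. -/
noncomputable def classicalValue {mA mB : ℕ} {dA : Fin mA → ℕ} {dB : Fin mB → ℕ}
    (B : Box dA dB) : ℝ :=
  sSup (bellValue B '' classicalPolytope dA dB)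

/-- `ω_q̃`, the maximum of the Bell expression over the almost quantum set. -/
noncomputable def almostQuantumValue {mA mB : ℕ} {dA : Fin mA → ℕ} {dB : Fin mB → ℕ}
    (B : Box dA dB) : ℝ :=
  sSup (bellValue B '' almostQuantumSet dA dB)

/-! Suppose an inequality supporting a facet of the classical polytope holds on the almost quantum
set. Moment matrices are parametrized by real matrices `Y` on pairs of deterministic strategies; the
only constraint besides positivity and normalization is the linear one that exclusive pairs of
events have moment zero. On this subspace the functional ω Γ(1,1) − Σ B(e) Γ(e,e) is non-negative on
positive forms, and M. Riesz extension (`exists_extension_slackFunctional`) makes it a functional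
non-negative on all positive forms, that is, a positive semidefinite bilinear form G on vectors of
strategies, with G(δ,δ) equal to the slack s(δ).

The radical of G contains every strategy of slack zero and every linear relation among deterministic
boxes. On a facet the boxes of slack zero span a hyperplane, so G has rank one: G(v,w) =
(s·v)(s·w)/κ, where κ = s(δ₀) ≠ 0. If v ⊗ w satisfies the orthogonality constraints, G(v,w) is also
(s·v) Σw. Comparing the two values gives `slack_mul_slack`.

Testing this identity on differences of strategies at distinct inputs, where Σw = 0, shows that many
products of differences of s vanish. By `depends_on_one_coordinate`, one party then enters s through
a single input x, and for each answer a to it the other party enters through a single input y(a).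
Hence s extends to no-signalling boxes as Σ s(a,b) P(a,b|x,y(a)) with s(a,b) ≥ 0, and the inequality
holds on the whole no-signalling polytope. Both polytopes have the same affine hull, so it supports
a facet there too and is trivial. -/

variable {mA mB : ℕ} {dA : Fin mA → ℕ} {dB : Fin mB → ℕ}

/-! ### Deterministic strategies -/

/-- The response function of the deterministic strategy `α` of one party. -/
def response {m : ℕ} {d : Fin m → ℕ} (α : ∀ x, Fin (d x)) (u : LocalEvent d) : ℝ :=
  if α u.1 = u.2 then 1 else 0

/-- A deterministic strategy of Alice together with one of Bob. -/
abbrev Strategy {mA mB : ℕ} (dA : Fin mA → ℕ) (dB : Fin mB → ℕ) : Type :=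
  (∀ x, Fin (dA x)) × (∀ y, Fin (dB y))

/-- The box in which the two parties answer with the strategies `δ.1` and `δ.2`. -/
def deterministicBox (δ : Strategy dA dB) : Box dA dB :=
  fun e => response δ.1 e.1 * response δ.2 e.2

lemma sum_response {m : ℕ} {d : Fin m → ℕ} (α : ∀ x, Fin (d x)) (x : Fin m) :
    ∑ a, response α ⟨x, a⟩ = 1 := by
  simp [response]

lemma response_nonneg {m : ℕ} {d : Fin m → ℕ} (α : ∀ x, Fin (d x)) (u : LocalEvent d) :
    0 ≤ response α u := by
  unfold response; split_ifs <;> norm_num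

lemma response_eq_zero_or_one {m : ℕ} {d : Fin m → ℕ} (α : ∀ x, Fin (d x))
    (u : LocalEvent d) : response α u = 0 ∨ response α u = 1 := by
  unfold response; split_ifs <;> simp

lemma response_mul_response_of_ne {m : ℕ} {d : Fin m → ℕ} (α : ∀ x, Fin (d x))
    {u v : LocalEvent d} (h : u.1 = v.1) (huv : u ≠ v) : response α u * response α v = 0 := by
  obtain ⟨x, a⟩ := u
  obtain ⟨y, b⟩ := v
  obtain rfl : x = y := h
  unfold response
  split_ifs with h1 h2 <;> simp_all

lemma response_update_of_ne {m : ℕ} {d : Fin m → ℕ} (α : ∀ x, Fin (d x)) (x : Fin m)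
    (a : Fin (d x)) {u : LocalEvent d} (h : u.1 ≠ x) :
    response (Function.update α x a) u = response α u := by
  simp [response, h]

lemma isNoSignalling_deterministicBox (δ : Strategy dA dB) :
    IsNoSignalling (deterministicBox δ) where
  nonneg e := mul_nonneg (response_nonneg _ _) (response_nonneg _ _)
  normalized x y := by
    simp [deterministicBox, ← Finset.mul_sum, sum_response]
  noSignalling_to_Bob x x' y b := by
    simp [deterministicBox, ← Finset.sum_mul, sum_response]
  noSignalling_to_Alice y y' x a := by
    simp [deterministicBox, ← Finset.mul_sum, sum_response]

lemma deterministicBox_mem (δ : Strategy dA dB) :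
    deterministicBox δ ∈ localDeterministicBoxes dA dB := by
  refine ⟨isNoSignalling_deterministicBox δ, fun e => ?_⟩
  rcases response_eq_zero_or_one δ.1 e.1 with h | h <;>
    rcases response_eq_zero_or_one δ.2 e.2 with h' | h' <;> simp [deterministicBox, h, h']

lemma IsNoSignalling.le_one {P : Box dA dB} (hP : IsNoSignalling P) (e : BellEvent dA dB) :
    P e ≤ 1 := by
  obtain ⟨⟨x, a⟩, ⟨y, b⟩⟩ := e
  rw [← hP.normalized x y]
  refine le_trans ?_ (Finset.single_le_sum
    (f := fun a => ∑ b : Fin (dB y), P (⟨x, a⟩, ⟨y, b⟩))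
    (fun a _ => Finset.sum_nonneg fun b _ => hP.nonneg _) (Finset.mem_univ a))
  exact Finset.single_le_sum (f := fun b => P (⟨x, a⟩, ⟨y, b⟩))
    (fun b _ => hP.nonneg _) (Finset.mem_univ b)

lemma IsNoSignalling.exists_pos {P : Box dA dB} (hP : IsNoSignalling P) (x : Fin mA)
    (y : Fin mB) : ∃ a b, 0 < P (⟨x, a⟩, ⟨y, b⟩) := by
  by_contra! h
  have := hP.normalized x y
  rw [Finset.sum_eq_zero fun a _ => Finset.sum_eq_zero fun b _ =>
    le_antisymm (h a b) (hP.nonneg _)] at this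
  exact zero_ne_one this

/-- Each pair of inputs has exactly one entry equal to 1. By no-signalling the answer of each party
there does not depend on the other's input, so it can be read off at the reference inputs `x0`,
`y0`. -/
lemma exists_deterministicBox_eq [Nonempty (Fin mA)] [Nonempty (Fin mB)] {P : Box dA dB}
    (hP : P ∈ localDeterministicBoxes dA dB) : ∃ δ, deterministicBox δ = P := by
  obtain ⟨hns, h01⟩ := hP
  have x0 := Classical.arbitrary (Fin mA)
  have y0 := Classical.arbitrary (Fin mB)
  choose a b hab using hns.exists_pos
  have hcases : ∀ x y a' b', 0 < P (⟨x, a'⟩, ⟨y, b'⟩) → a' = a x y0 ∧ b' = b x0 y := by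
    intro x y a' b' hpos
    have h1 : P (⟨x, a'⟩, ⟨y, b'⟩) = 1 := (h01 _).resolve_left hpos.ne'
    have hzero : ∀ a'' b'', (a'' ≠ a' ∨ b'' ≠ b') → P (⟨x, a''⟩, ⟨y, b''⟩) = 0 := by
      intro a'' b'' hne
      refine (h01 _).resolve_right fun h2 => ?_
      have hs := hns.normalized x y
      rw [← Fintype.sum_prod_type' (f := fun a b => P (⟨x, a⟩, ⟨y, b⟩))] at hs
      have hle := Finset.add_le_sum (s := Finset.univ)
        (f := fun p : Fin (dA x) × Fin (dB y) => P (⟨x, p.1⟩, ⟨y, p.2⟩))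
        (fun p _ => hns.nonneg _) (Finset.mem_univ (a', b')) (Finset.mem_univ (a'', b''))
        (by rintro h; simp only [Prod.mk.injEq] at h; rcases hne with h' | h' <;> simp_all)
      simp only [h1, h2] at hle
      linarith
    constructor
    · by_contra hne
      have h2 := hns.noSignalling_to_Alice y y0 x (a x y0)
      rw [Finset.sum_eq_zero fun b'' _ => hzero _ _ (Or.inl (Ne.symm hne))] at h2
      have h3 := Finset.single_le_sum (f := fun b => P (⟨x, a x y0⟩, ⟨y0, b⟩))
        (fun b _ => hns.nonneg _) (Finset.mem_univ (b x y0))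
      have h4 := hab x y0
      linarith
    · by_contra hne
      have h2 := hns.noSignalling_to_Bob x x0 y (b x0 y)
      rw [Finset.sum_eq_zero fun a'' _ => hzero _ _ (Or.inr (Ne.symm hne))] at h2
      have h3 := Finset.single_le_sum (f := fun a => P (⟨x0, a⟩, ⟨y, b x0 y⟩))
        (fun b _ => hns.nonneg _) (Finset.mem_univ (a x0 y))
      have h4 := hab x0 y
      linarith
  refine ⟨(fun x => a x y0, fun y => b x0 y), funext fun ⟨⟨x, a'⟩, ⟨y, b'⟩⟩ => ?_⟩
  by_cases hpos : 0 < P (⟨x, a'⟩, ⟨y, b'⟩)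
  · obtain ⟨h1, h2⟩ := hcases x y a' b' hpos
    rw [(h01 _).resolve_left hpos.ne']
    simp [deterministicBox, response, h1, h2]
  · have h0 : P (⟨x, a'⟩, ⟨y, b'⟩) = 0 := le_antisymm (not_lt.mp hpos) (hns.nonneg _)
    rw [h0]
    simp only [deterministicBox, response, mul_eq_zero, ite_eq_right_iff, one_ne_zero, imp_false]
    by_contra! hc
    obtain ⟨h1, h2⟩ := hcases x y _ _ (hab x y)
    rw [← h1, ← h2] at hc
    apply hpos
    rw [← hc.1, ← hc.2]
    exact hab x y

/-! ### No-signalling boxes are affine combinations of deterministic boxes -/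

/-- Updating `α₀` at the input `w.1` changes the response at that input only, so only the terms with
`w.1 = u.1` survive. Their subtracted parts add up to the leading term because the total `s` is the
same for all inputs. -/
lemma eq_response_combination {m : ℕ} {d : Fin m → ℕ} (α₀ : ∀ x, Fin (d x))
    {p : LocalEvent d → ℝ} {s : ℝ} (hp : ∀ x, ∑ a, p ⟨x, a⟩ = s) (u : LocalEvent d) :
    p u = s * response α₀ u + ∑ w : LocalEvent d,
      p w * (response (Function.update α₀ w.1 w.2) u - response α₀ u) := by
  obtain ⟨x, a⟩ := u
  rw [Fintype.sum_sigma, Finset.sum_eq_single x]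
  · simp only [mul_sub, Finset.sum_sub_distrib, ← Finset.sum_mul, hp]
    simp [response]
  · intro x' _ hx'
    exact Finset.sum_eq_zero fun a' _ => by
      rw [response_update_of_ne _ _ _ (by simpa using hx'.symm)]; simp
  · simp

lemma response_mul_mem_span (β₀ : ∀ y, Fin (dB y)) (α : ∀ x, Fin (dA x))
    {p : LocalEvent dB → ℝ} {s : ℝ} (hp : ∀ y, ∑ b, p ⟨y, b⟩ = s) :
    (fun e : BellEvent dA dB => response α e.1 * p e.2) ∈
      Submodule.span ℝ (Set.range (deterministicBox (dA := dA) (dB := dB))) := by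
  have hmem : ∀ β, deterministicBox (α, β) ∈
      Submodule.span ℝ (Set.range (deterministicBox (dA := dA) (dB := dB))) :=
    fun β => Submodule.subset_span ⟨_, rfl⟩
  have : (fun e : BellEvent dA dB => response α e.1 * p e.2) =
      s • deterministicBox (α, β₀) + ∑ w : LocalEvent dB, p w •
        (deterministicBox (α, Function.update β₀ w.1 w.2) - deterministicBox (α, β₀)) := by
    funext e
    rw [eq_response_combination β₀ hp e.2]
    simp only [deterministicBox, Pi.add_apply, Pi.smul_apply, Finset.sum_apply, Pi.sub_apply,
      smul_eq_mul, mul_add, Finset.mul_sum]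
    congr 1
    · ring
    · exact Finset.sum_congr rfl fun w _ => by ring
  rw [this]
  exact add_mem (Submodule.smul_mem _ _ (hmem _)) (sum_mem fun w _ =>
    Submodule.smul_mem _ _ (sub_mem (hmem _) (hmem _)))

/-- The one-party expansion is applied in Alice's argument and then in Bob's. No-signalling is what
gives each function being expanded an input-independent total. -/
lemma IsNoSignalling.mem_span [Nonempty (Fin mA)] [Nonempty (Fin mB)] (δ₀ : Strategy dA dB)
    {P : Box dA dB} (hP : IsNoSignalling P) :
    P ∈ Submodule.span ℝ (Set.range (deterministicBox (dA := dA) (dB := dB))) := by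
  have x0 := Classical.arbitrary (Fin mA)
  have y0 := Classical.arbitrary (Fin mB)
  have hrow : ∀ (α : ∀ x, Fin (dA x)) (w : LocalEvent dA),
      (fun e : BellEvent dA dB => response α e.1 * P (w, e.2)) ∈
        Submodule.span ℝ (Set.range (deterministicBox (dA := dA) (dB := dB))) := fun α w =>
    response_mul_mem_span δ₀.2 α (p := fun v => P (w, v))
      (s := ∑ b, P (w, ⟨y0, b⟩)) fun y => hP.noSignalling_to_Alice y y0 w.1 w.2
  have : P = (fun e => response δ₀.1 e.1 * ∑ a, P (⟨x0, a⟩, e.2)) +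
      ∑ w : LocalEvent dA, ((fun e => response (Function.update δ₀.1 w.1 w.2) e.1 * P (w, e.2)) -
        fun e => response δ₀.1 e.1 * P (w, e.2)) := by
    funext e
    rw [show P e = P (e.1, e.2) from rfl, eq_response_combination δ₀.1 (p := fun u => P (u, e.2))
      (s := ∑ a, P (⟨x0, a⟩, e.2)) (fun x => hP.noSignalling_to_Bob x x0 e.2.1 e.2.2) e.1]
    simp only [Pi.add_apply, Finset.sum_apply, Pi.sub_apply]
    congr 1
    · ring
    · exact Finset.sum_congr rfl fun w _ => by ring
  rw [this]
  refine add_mem (response_mul_mem_span δ₀.2 δ₀.1 (p := fun v => ∑ a, P (⟨x0, a⟩, v)) (s := 1)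
    fun y => ?_) (sum_mem fun w _ => sub_mem (hrow _ _) (hrow _ _))
  rw [Finset.sum_comm]
  exact hP.normalized x0 y

lemma IsNoSignalling.exists_affine_combination [Nonempty (Fin mA)] [Nonempty (Fin mB)]
    (δ₀ : Strategy dA dB) {P : Box dA dB} (hP : IsNoSignalling P) :
    ∃ c : Strategy dA dB → ℝ, ∑ δ, c δ = 1 ∧ ∑ δ, c δ • deterministicBox δ = P := by
  obtain ⟨c, hc⟩ := (Submodule.mem_span_range_iff_exists_fun ℝ).1 (hP.mem_span δ₀)
  refine ⟨c, ?_, hc⟩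
  have x0 := Classical.arbitrary (Fin mA)
  have y0 := Classical.arbitrary (Fin mB)
  rw [← hP.normalized x0 y0, ← hc]
  simp only [Finset.sum_apply, Pi.smul_apply, smul_eq_mul]
  symm
  calc _ = ∑ a, ∑ δ, ∑ b, c δ * deterministicBox δ (⟨x0, a⟩, ⟨y0, b⟩) :=
        Finset.sum_congr rfl fun a _ => Finset.sum_comm
    _ = ∑ δ, ∑ a, ∑ b, c δ * deterministicBox δ (⟨x0, a⟩, ⟨y0, b⟩) := Finset.sum_comm
    _ = ∑ δ, c δ := Finset.sum_congr rfl fun δ _ => by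
        simp only [← Finset.mul_sum, (isNoSignalling_deterministicBox δ).normalized, mul_one]

/-! ### Moment matrices -/

/-- Two local events are exclusive if they are different outputs of the same input. -/
def LocallyExclusive {m : ℕ} {d : Fin m → ℕ} (u v : LocalEvent d) : Prop :=
  u.1 = v.1 ∧ u ≠ v

/-- Two events are exclusive if they are locally exclusive for one of the parties. -/
def Exclusive (e f : BellEvent dA dB) : Prop :=
  LocallyExclusive e.1 f.1 ∨ LocallyExclusive e.2 f.2

lemma Exclusive.symm {e f : BellEvent dA dB} (h : Exclusive e f) : Exclusive f e :=
  h.imp (fun h => ⟨h.1.symm, h.2.symm⟩) fun h => ⟨h.1.symm, h.2.symm⟩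

/-- The value of an operator of level `1 + AB` on a deterministic strategy. -/
def operatorValue (δ : Strategy dA dB) : OpIndex dA dB → ℝ
  | none => 1
  | some e => deterministicBox δ e

/-- The moment matrix with coefficients `Y` in pairs of deterministic strategies. -/
def momentMatrix (Y : Matrix (Strategy dA dB) (Strategy dA dB) ℝ) :
    Matrix (OpIndex dA dB) (OpIndex dA dB) ℝ :=
  fun i j => ∑ δ, ∑ δ', Y δ δ' * (operatorValue δ i * operatorValue δ' j)

lemma momentMatrix_add (Y Z : Matrix (Strategy dA dB) (Strategy dA dB) ℝ) :
    momentMatrix (Y + Z) = momentMatrix Y + momentMatrix Z := by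
  ext i j
  simp [momentMatrix, add_mul, Finset.sum_add_distrib]

lemma momentMatrix_smul (c : ℝ) (Y : Matrix (Strategy dA dB) (Strategy dA dB) ℝ) :
    momentMatrix (c • Y) = c • momentMatrix Y := by
  ext i j
  simp [momentMatrix, Finset.mul_sum, mul_assoc]

lemma momentMatrix_transpose (Y : Matrix (Strategy dA dB) (Strategy dA dB) ℝ)
    (i j : OpIndex dA dB) : momentMatrix Y.transpose i j = momentMatrix Y j i := by
  unfold momentMatrix
  rw [Finset.sum_comm]
  simp only [Matrix.transpose_apply, mul_comm]

lemma momentMatrix_vecMulVec (v w : Strategy dA dB → ℝ) (i j : OpIndex dA dB) :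
    momentMatrix (Matrix.vecMulVec v w) i j =
      (∑ δ, v δ * operatorValue δ i) * ∑ δ, w δ * operatorValue δ j := by
  rw [Finset.sum_mul_sum]
  exact Finset.sum_congr rfl fun δ _ => Finset.sum_congr rfl fun δ' _ => by
    rw [Matrix.vecMulVec_apply]; ring

/-- The coefficient matrices whose moment matrix vanishes on exclusive pairs of events. -/
def orthogonalCoefficients (dA : Fin mA → ℕ) (dB : Fin mB → ℕ) :
    Submodule ℝ (Matrix (Strategy dA dB) (Strategy dA dB) ℝ) where
  carrier := {Y | ∀ e f, Exclusive e f → momentMatrix Y (some e) (some f) = 0}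
  add_mem' hY hZ e f h := by simp [momentMatrix_add, hY e f h, hZ e f h]
  zero_mem' e f _ := by simp [momentMatrix]
  smul_mem' c Y hY e f h := by simp [momentMatrix_smul, hY e f h]

lemma mem_orthogonalCoefficients {Y : Matrix (Strategy dA dB) (Strategy dA dB) ℝ} :
    Y ∈ orthogonalCoefficients dA dB ↔
      ∀ e f, Exclusive e f → momentMatrix Y (some e) (some f) = 0 := Iff.rfl

lemma transpose_mem_orthogonalCoefficients
    {Y : Matrix (Strategy dA dB) (Strategy dA dB) ℝ} (hY : Y ∈ orthogonalCoefficients dA dB) :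
    Y.transpose ∈ orthogonalCoefficients dA dB := fun e f h => by
  rw [momentMatrix_transpose]; exact hY f e h.symm

lemma vecMulVec_mem_orthogonalCoefficients {v w : Strategy dA dB → ℝ} :
    Matrix.vecMulVec v w ∈ orthogonalCoefficients dA dB ↔ ∀ e f, Exclusive e f →
      (∑ δ, v δ * deterministicBox δ e) * (∑ δ, w δ * deterministicBox δ f) = 0 := by
  simp only [mem_orthogonalCoefficients, momentMatrix_vecMulVec, operatorValue]

lemma deterministicBox_mul_of_exclusive (δ : Strategy dA dB) {e f : BellEvent dA dB}
    (h : Exclusive e f) : deterministicBox δ e * deterministicBox δ f = 0 := by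
  unfold deterministicBox
  rcases h with h | h
  · rw [mul_mul_mul_comm, response_mul_response_of_ne _ h.1 h.2, zero_mul]
  · rw [mul_mul_mul_comm, response_mul_response_of_ne _ h.1 h.2, mul_zero]

lemma diagonal_mem_orthogonalCoefficients (c : Strategy dA dB → ℝ) :
    Matrix.diagonal c ∈ orthogonalCoefficients dA dB := by
  intro e f h
  refine Finset.sum_eq_zero fun δ _ => Finset.sum_eq_zero fun δ' _ => ?_
  by_cases hδ : δ = δ'
  · subst hδ
    simp [operatorValue, deterministicBox_mul_of_exclusive δ h]
  · simp [hδ]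

lemma sum_momentMatrix_some (Y : Matrix (Strategy dA dB) (Strategy dA dB) ℝ) (x : Fin mA)
    (y : Fin mB) (j : OpIndex dA dB) :
    ∑ a, ∑ b, momentMatrix Y (some (⟨x, a⟩, ⟨y, b⟩)) j = momentMatrix Y none j := by
  have key : ∀ δ : Strategy dA dB,
      ∑ p : Fin (dA x) × Fin (dB y), operatorValue δ (some (⟨x, p.1⟩, ⟨y, p.2⟩)) = 1 := fun δ => by
    rw [Fintype.sum_prod_type]
    exact (isNoSignalling_deterministicBox δ).normalized x y
  rw [← Fintype.sum_prod_type' (f := fun a b => momentMatrix Y (some (⟨x, a⟩, ⟨y, b⟩)) j)]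
  unfold momentMatrix
  rw [Finset.sum_comm]
  refine Finset.sum_congr rfl fun δ _ => ?_
  rw [Finset.sum_comm]
  refine Finset.sum_congr rfl fun δ' _ => ?_
  rw [← Finset.mul_sum, ← Finset.sum_mul, key]
  rfl

/-- The identity is the sum of the events at the input pair of `e`; all of these except `e` itself
are exclusive with `e`. -/
lemma momentMatrix_none_some {Y : Matrix (Strategy dA dB) (Strategy dA dB) ℝ}
    (hY : Y ∈ orthogonalCoefficients dA dB) (e : BellEvent dA dB) :
    momentMatrix Y none (some e) = momentMatrix Y (some e) (some e) := by
  obtain ⟨⟨x, a⟩, ⟨y, b⟩⟩ := e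
  rw [← sum_momentMatrix_some Y x y, Finset.sum_eq_single a, Finset.sum_eq_single b]
  · intro b' _ hb
    exact hY _ _ (Or.inr ⟨rfl, by simpa using hb⟩)
  · simp
  · intro a' _ ha
    exact Finset.sum_eq_zero fun b' _ => hY _ _ (Or.inl ⟨rfl, by simpa using ha⟩)
  · simp

lemma momentMatrix_some_none {Y : Matrix (Strategy dA dB) (Strategy dA dB) ℝ}
    (hY : Y ∈ orthogonalCoefficients dA dB) (e : BellEvent dA dB) :
    momentMatrix Y (some e) none = momentMatrix Y (some e) (some e) := by
  rw [← momentMatrix_transpose,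
    momentMatrix_none_some (transpose_mem_orthogonalCoefficients hY), momentMatrix_transpose]

/-! ### Almost quantum boxes from moment matrices -/

/-- The entry of the moment matrix determined by a reduced word. -/
noncomputable def momentOfWord (Y : Matrix (Strategy dA dB) (Strategy dA dB) ℝ) :
    Option (List (LocalEvent dA) × List (LocalEvent dB)) → ℝ
  | some ([u], [v]) => momentMatrix Y (some (u, v)) (some (u, v))
  | some ([u, u'], [v]) => momentMatrix Y (some (u, v)) (some (u', v))
  | some ([u], [v, v']) => momentMatrix Y (some (u, v)) (some (u, v'))
  | some ([u, u'], [v, v']) => momentMatrix Y (some (u, v)) (some (u', v'))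
  -- `daggerProduct` reaches this case only with the empty words `([], [])`.
  | some _ => momentMatrix Y none none
  | none => 0

/-- The only coincidences that are not immediate come from the word `([u], [v])`, produced by 1·e,
e·1 and e·e. -/
lemma momentMatrix_eq_momentOfWord {Y : Matrix (Strategy dA dB) (Strategy dA dB) ℝ}
    (hY : Y ∈ orthogonalCoefficients dA dB) (Q R : OpIndex dA dB) :
    momentMatrix Y Q R = momentOfWord Y (daggerProduct Q R) := by
  rcases Q with _ | ⟨u, v⟩ <;> rcases R with _ | ⟨u', v'⟩
  · rfl
  · exact momentMatrix_none_some hY _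
  · exact momentMatrix_some_none hY _
  · simp only [daggerProduct, Option.map_some, localProduct]
    split_ifs with h1 h2 h3 h4 h5 h6 h7
    all_goals first
      | (subst_vars; rfl)
      | exact hY _ _ (Or.inl ⟨by assumption, by assumption⟩)
      | exact hY _ _ (Or.inr ⟨by assumption, by assumption⟩)

lemma posSemidef_momentMatrix {Y : Matrix (Strategy dA dB) (Strategy dA dB) ℝ}
    (hY : Y.PosSemidef) : ((momentMatrix Y).map ((↑) : ℝ → ℂ)).PosSemidef := by
  obtain ⟨n, A, rfl⟩ := Matrix.posSemidef_iff_eq_sum_vecMulVec.1 hY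
  have h : (momentMatrix (∑ i, Matrix.vecMulVec (A i) (star (A i)))).map ((↑) : ℝ → ℂ) =
      ∑ i, Matrix.vecMulVec (fun j => ((∑ δ, A i δ * operatorValue δ j : ℝ) : ℂ))
        (star fun j => ((∑ δ, A i δ * operatorValue δ j : ℝ) : ℂ)) := by
    have hsum : momentMatrix (∑ i, Matrix.vecMulVec (A i) (star (A i))) =
        ∑ i, momentMatrix (Matrix.vecMulVec (A i) (star (A i))) :=
      map_sum (AddMonoidHom.mk' momentMatrix momentMatrix_add) _ _
    ext j k
    rw [Matrix.map_apply, hsum, Matrix.sum_apply, Matrix.sum_apply, Complex.ofReal_sum]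
    refine Finset.sum_congr rfl fun i _ => ?_
    rw [momentMatrix_vecMulVec, Matrix.vecMulVec_apply, Pi.star_apply, Complex.ofReal_mul]
    simp
  rw [h]
  exact Matrix.posSemidef_sum _ fun i _ => Matrix.posSemidef_vecMulVec_self_star _

lemma momentMatrix_mem_almostQuantumSet {Y : Matrix (Strategy dA dB) (Strategy dA dB) ℝ}
    (hY : Y ∈ orthogonalCoefficients dA dB) (hpos : Y.PosSemidef)
    (h1 : momentMatrix Y none none = 1) :
    (fun e => momentMatrix Y (some e) (some e)) ∈ almostQuantumSet dA dB := by
  -- The diagonal is a linear combination of deterministic boxes, weighted by the row sums of `Y`,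
  -- so no-signalling is inherited from them.
  have hdiag : ∀ e, momentMatrix Y (some e) (some e) = ∑ δ, ∑ δ', Y δ δ' * deterministicBox δ e :=
    fun e => by
      rw [← momentMatrix_some_none hY]
      simp [momentMatrix, operatorValue]
  refine ⟨⟨fun e => ?_, fun x y => ?_, fun x x' y b => ?_, fun y y' x a => ?_⟩,
    (momentMatrix Y).map ((↑) : ℝ → ℂ), posSemidef_momentMatrix hpos, ?_, ?_, ?_, ?_⟩
  · have := (posSemidef_momentMatrix hpos).diag_nonneg (i := some e)
    simpa using this
  · simp only [← momentMatrix_some_none hY]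
    rw [sum_momentMatrix_some, h1]
  · simp only [hdiag]
    rw [Finset.sum_comm, Finset.sum_comm (γ := Fin (dA x'))]
    refine Finset.sum_congr rfl fun δ _ => ?_
    rw [Finset.sum_comm, Finset.sum_comm (γ := Fin (dA x'))]
    refine Finset.sum_congr rfl fun δ' _ => ?_
    rw [← Finset.mul_sum, ← Finset.mul_sum,
      (isNoSignalling_deterministicBox δ).noSignalling_to_Bob x x' y b]
  · simp only [hdiag]
    rw [Finset.sum_comm, Finset.sum_comm (γ := Fin (dB y'))]
    refine Finset.sum_congr rfl fun δ _ => ?_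
    rw [Finset.sum_comm, Finset.sum_comm (γ := Fin (dB y'))]
    refine Finset.sum_congr rfl fun δ' _ => ?_
    rw [← Finset.mul_sum, ← Finset.mul_sum,
      (isNoSignalling_deterministicBox δ).noSignalling_to_Alice y y' x a]
  · simp [h1]
  · intro Q R S T h
    simp only [Matrix.map_apply, momentMatrix_eq_momentOfWord hY, h]
  · intro Q R h
    simp [momentMatrix_eq_momentOfWord hY, h, momentOfWord]
  · intro e
    simp [momentMatrix_none_some hY]

lemma deterministicBox_mem_almostQuantumSet (δ : Strategy dA dB) :
    deterministicBox δ ∈ almostQuantumSet dA dB := by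
  have h := momentMatrix_mem_almostQuantumSet
    (diagonal_mem_orthogonalCoefficients (Pi.single δ 1))
    (Matrix.PosSemidef.diagonal (Pi.single_nonneg.2 zero_le_one))
    (by simp [momentMatrix, operatorValue, Matrix.diagonal_apply])
  convert h using 1
  funext e
  have : ∀ r : ℝ, r = 0 ∨ r = 1 → r = r * r := by rintro r (rfl | rfl) <;> norm_num
  simp only [momentMatrix, Matrix.diagonal_apply, operatorValue, ite_mul, zero_mul,
    Finset.sum_ite_eq, Finset.mem_univ, if_true]
  rw [Finset.sum_eq_single δ (fun δ' _ h => by simp [h]) (by simp), Pi.single_eq_same, one_mul]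
  exact this _ ((deterministicBox_mem δ).2 e)

/-! ### The dual certificate -/

/-- The cone of square matrices with non-negative quadratic form. -/
def nonnegQuadraticForms (ι : Type*) [Fintype ι] : PointedCone ℝ (Matrix ι ι ℝ) where
  carrier := {Y | ∀ v : ι → ℝ, 0 ≤ ∑ i, ∑ j, Y i j * (v i * v j)}
  add_mem' hY hZ v := by
    simp only [Matrix.add_apply, add_mul, Finset.sum_add_distrib]
    exact add_nonneg (hY v) (hZ v)
  zero_mem' v := by simp
  smul_mem' c Y hY v := by
    have : ∑ i, ∑ j, (c • Y) i j * (v i * v j) = c.1 * ∑ i, ∑ j, Y i j * (v i * v j) := by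
      simp only [Finset.mul_sum, ← mul_assoc]; rfl
    rw [this]
    exact mul_nonneg c.2 (hY v)

lemma sum_vecMulVec_mul {ι : Type*} [Fintype ι] (v w u : ι → ℝ) :
    ∑ i, ∑ j, Matrix.vecMulVec v w i j * (u i * u j) = (∑ i, v i * u i) * ∑ j, w j * u j := by
  rw [Finset.sum_mul_sum]
  exact Finset.sum_congr rfl fun i _ => Finset.sum_congr rfl fun j _ => by
    rw [Matrix.vecMulVec_apply]; ring

lemma vecMulVec_self_mem_nonnegQuadraticForms {ι : Type*} [Fintype ι] (v : ι → ℝ) :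
    Matrix.vecMulVec v v ∈ nonnegQuadraticForms ι := fun u => by
  rw [sum_vecMulVec_mul]; exact mul_self_nonneg _

/-- The cone does not require symmetry, so it contains every antisymmetric matrix together with its
negative. A functional non-negative on the cone therefore vanishes on these, which makes its
bilinear form symmetric. -/
lemma vecMulVec_sub_mem_nonnegQuadraticForms {ι : Type*} [Fintype ι] (v w : ι → ℝ) :
    Matrix.vecMulVec v w - Matrix.vecMulVec w v ∈ nonnegQuadraticForms ι := fun u => by
  simp only [Matrix.sub_apply, sub_mul, Finset.sum_sub_distrib, sum_vecMulVec_mul]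
  rw [mul_comm, sub_self]

/-- Diagonal dominance. Diagonal matrices satisfy the orthogonality constraints, so this is the
domination hypothesis of `riesz_extension`. -/
lemma exists_diagonal_add_mem_nonnegQuadraticForms {ι : Type*} [Fintype ι] [DecidableEq ι]
    (Y : Matrix ι ι ℝ) : ∃ c : ι → ℝ, Matrix.diagonal c + Y ∈ nonnegQuadraticForms ι := by
  refine ⟨fun i => ∑ j, (|Y i j| + |Y j i|), fun v => ?_⟩
  have h1 : ∀ i, ∑ j, Matrix.diagonal (fun i => ∑ j, (|Y i j| + |Y j i|)) i j * (v i * v j) =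
      ∑ j, (|Y i j| + |Y j i|) * (v i * v i) := fun i => by
    simp [Matrix.diagonal_apply, Finset.sum_mul]
  have h2 : ∑ i, ∑ j, (|Y i j| + |Y j i|) * (v i * v i) =
      ∑ i, ∑ j, |Y i j| * (v i * v i + v j * v j) := by
    simp only [add_mul, mul_add, Finset.sum_add_distrib]
    congr 1
    exact Finset.sum_comm
  have h3 : ∑ i, ∑ j, (Matrix.diagonal (fun i => ∑ j, (|Y i j| + |Y j i|)) + Y) i j *
      (v i * v j) = ∑ i, (∑ j, (|Y i j| + |Y j i|) * (v i * v i) + ∑ j, Y i j * (v i * v j)) :=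
    Finset.sum_congr rfl fun i _ => by
      rw [← h1 i, ← Finset.sum_add_distrib]
      exact Finset.sum_congr rfl fun j _ => by rw [Matrix.add_apply, add_mul]
  rw [h3, Finset.sum_add_distrib, h2, ← Finset.sum_add_distrib]
  refine Finset.sum_nonneg fun i _ => ?_
  rw [← Finset.sum_add_distrib]
  refine Finset.sum_nonneg fun j _ => ?_
  nlinarith [abs_nonneg (Y i j), neg_abs_le (Y i j), le_abs_self (Y i j), sq_nonneg (v i + v j),
    sq_nonneg (v i - v j), mul_nonneg (abs_nonneg (Y i j)) (sq_nonneg (v i)),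
    mul_nonneg (abs_nonneg (Y i j)) (sq_nonneg (v j)),
    mul_nonneg (sub_nonneg.2 (le_abs_self (Y i j))) (sq_nonneg (v i - v j)),
    mul_nonneg (by linarith [neg_abs_le (Y i j)] : 0 ≤ |Y i j| + Y i j) (sq_nonneg (v i + v j))]

lemma posSemidef_smul_add_transpose {ι : Type*} [Fintype ι] {Y : Matrix ι ι ℝ}
    (hY : Y ∈ nonnegQuadraticForms ι) {c : ℝ} (hc : 0 ≤ c) :
    (c • (Y + Y.transpose)).PosSemidef := by
  refine Matrix.PosSemidef.smul ?_ hc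
  refine Matrix.PosSemidef.of_dotProduct_mulVec_nonneg ?_ fun v => ?_
  · rw [Matrix.IsHermitian, Matrix.conjTranspose_eq_transpose_of_trivial, Matrix.transpose_add,
      Matrix.transpose_transpose, add_comm]
  · have h : star v ⬝ᵥ (Y + Y.transpose).mulVec v =
        ∑ i, ∑ j, Y i j * (v i * v j) + ∑ j, ∑ i, Y i j * (v i * v j) := by
      rw [← Finset.sum_add_distrib]
      simp only [dotProduct, Matrix.mulVec, Finset.mul_sum]
      refine Finset.sum_congr rfl fun i _ => ?_
      rw [← Finset.sum_add_distrib]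
      refine Finset.sum_congr rfl fun j _ => ?_
      simp only [star_trivial, Matrix.add_apply, Matrix.transpose_apply]
      ring
    rw [h, Finset.sum_comm (γ := ι), ← two_mul]
    rw [Finset.sum_comm]
    exact mul_nonneg zero_le_two (hY v)

/-- The functional `ω Γ(1, 1) - ∑ B(e) Γ(e, e)` of the moment matrix `Γ`. -/
def slackFunctional (B : Box dA dB) (ω : ℝ) :
    Matrix (Strategy dA dB) (Strategy dA dB) ℝ →ₗ[ℝ] ℝ where
  toFun Y := ω * momentMatrix Y none none - ∑ e, B e * momentMatrix Y (some e) (some e)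
  map_add' Y Z := by
    simp only [momentMatrix_add, Matrix.add_apply, mul_add, Finset.sum_add_distrib]
    ring
  map_smul' c Y := by
    simp only [momentMatrix_smul, Matrix.smul_apply, smul_eq_mul, mul_left_comm _ c,
      ← Finset.mul_sum, RingHom.id_apply]
    ring

lemma slackFunctional_apply (B : Box dA dB) (ω : ℝ)
    (Y : Matrix (Strategy dA dB) (Strategy dA dB) ℝ) :
    slackFunctional B ω Y =
      ω * momentMatrix Y none none - ∑ e, B e * momentMatrix Y (some e) (some e) := rfl

lemma slackFunctional_nonneg {B : Box dA dB} {ω : ℝ}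
    (hQ : ∀ P ∈ almostQuantumSet dA dB, bellValue B P ≤ ω)
    {Y : Matrix (Strategy dA dB) (Strategy dA dB) ℝ} (hY : Y ∈ orthogonalCoefficients dA dB)
    (hpos : Y ∈ nonnegQuadraticForms (Strategy dA dB)) : 0 ≤ slackFunctional B ω Y := by
  have hnn : ∀ i, 0 ≤ momentMatrix Y i i := fun i => hpos fun δ => operatorValue δ i
  rw [slackFunctional_apply]
  set t := momentMatrix Y none none with ht
  -- If Γ(1,1) = 0, the diagonal entries at each input pair are non-negative with sum zero.
  -- Otherwise symmetrizing and dividing by Γ(1,1) gives an almost quantum box.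
  rcases (hnn none).eq_or_lt with h0 | hlt
  · have hz : ∀ e, momentMatrix Y (some e) (some e) = 0 := by
      rintro ⟨⟨x, a⟩, ⟨y, b⟩⟩
      have hs := sum_momentMatrix_some Y x y none
      simp only [momentMatrix_some_none hY, ← h0] at hs
      have h2 := (Finset.sum_eq_zero_iff_of_nonneg
        fun a _ => Finset.sum_nonneg fun b _ => hnn (some (⟨x, a⟩, ⟨y, b⟩))).1 hs a
          (Finset.mem_univ a)
      exact (Finset.sum_eq_zero_iff_of_nonneg
        fun b _ => hnn (some (⟨x, a⟩, ⟨y, b⟩))).1 h2 b (Finset.mem_univ b)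
    simp [hz, ht, ← h0]
  · have htpos : 0 < t := hlt
    have hentry : ∀ i, momentMatrix ((2 * t)⁻¹ • (Y + Y.transpose)) i i =
        t⁻¹ * momentMatrix Y i i := fun i => by
      rw [momentMatrix_smul, momentMatrix_add, Matrix.smul_apply, Matrix.add_apply,
        momentMatrix_transpose, smul_eq_mul]
      field_simp
      ring
    have hmem := momentMatrix_mem_almostQuantumSet (Y := (2 * t)⁻¹ • (Y + Y.transpose))
      (Submodule.smul_mem _ _ (add_mem hY (transpose_mem_orthogonalCoefficients hY)))
      (posSemidef_smul_add_transpose hpos (by positivity))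
      (by rw [hentry]; exact inv_mul_cancel₀ htpos.ne')
    have hle := hQ _ hmem
    simp only [bellValue, hentry, mul_left_comm _ t⁻¹, ← Finset.mul_sum] at hle
    rw [inv_mul_le_iff₀ htpos] at hle
    linarith

lemma exists_extension_slackFunctional {B : Box dA dB} {ω : ℝ}
    (hQ : ∀ P ∈ almostQuantumSet dA dB, bellValue B P ≤ ω) :
    ∃ g : Matrix (Strategy dA dB) (Strategy dA dB) ℝ →ₗ[ℝ] ℝ,
      (∀ Y ∈ orthogonalCoefficients dA dB, g Y = slackFunctional B ω Y) ∧
        ∀ Y ∈ nonnegQuadraticForms (Strategy dA dB), 0 ≤ g Y := by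
  obtain ⟨g, hg, hg'⟩ := riesz_extension (nonnegQuadraticForms (Strategy dA dB))
    ⟨orthogonalCoefficients dA dB, (slackFunctional B ω).domRestrict _⟩
    (fun Y hY => slackFunctional_nonneg hQ Y.2 hY) fun Y => by
      obtain ⟨c, hc⟩ := exists_diagonal_add_mem_nonnegQuadraticForms Y
      exact ⟨⟨_, diagonal_mem_orthogonalCoefficients c⟩, hc⟩
  exact ⟨g, fun Y hY => hg ⟨Y, hY⟩, hg'⟩

/-- A linear functional on matrices as a bilinear form. -/
def vecMulVecForm {ι : Type*} (g : Matrix ι ι ℝ →ₗ[ℝ] ℝ) :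
    (ι → ℝ) →ₗ[ℝ] (ι → ℝ) →ₗ[ℝ] ℝ :=
  LinearMap.mk₂ ℝ (fun v w => g (Matrix.vecMulVec v w))
    (fun v v' w => by rw [Matrix.add_vecMulVec, map_add])
    (fun c v w => by rw [Matrix.smul_vecMulVec, map_smul])
    (fun v w w' => by rw [Matrix.vecMulVec_add, map_add])
    (fun c v w => by rw [Matrix.vecMulVec_smul, map_smul])

lemma vecMulVecForm_apply {ι : Type*} (g : Matrix ι ι ℝ →ₗ[ℝ] ℝ) (v w : ι → ℝ) :
    vecMulVecForm g v w = g (Matrix.vecMulVec v w) := rfl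

lemma vecMulVecForm_comm {ι : Type*} [Fintype ι] {g : Matrix ι ι ℝ →ₗ[ℝ] ℝ}
    (hg : ∀ Y ∈ nonnegQuadraticForms ι, 0 ≤ g Y) (v w : ι → ℝ) :
    vecMulVecForm g v w = vecMulVecForm g w v := by
  have h1 := hg _ (vecMulVec_sub_mem_nonnegQuadraticForms v w)
  have h2 := hg _ (vecMulVec_sub_mem_nonnegQuadraticForms w v)
  rw [map_sub] at h1 h2
  simp only [vecMulVecForm_apply]
  linarith

/-- Isotropic vectors of a positive semidefinite symmetric form lie in its radical: the form at `w +
s • v` is affine in `s` and bounded below. -/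
lemma mem_ker_vecMulVecForm {ι : Type*} [Fintype ι] {g : Matrix ι ι ℝ →ₗ[ℝ] ℝ}
    (hg : ∀ Y ∈ nonnegQuadraticForms ι, 0 ≤ g Y) {v : ι → ℝ} (hv : vecMulVecForm g v v = 0) :
    v ∈ LinearMap.ker (vecMulVecForm g) := by
  refine LinearMap.mem_ker.2 (LinearMap.ext fun w => ?_)
  have key : ∀ s : ℝ, 0 ≤ vecMulVecForm g w w + 2 * s * vecMulVecForm g v w := fun s => by
    have h : vecMulVecForm g (w + s • v) (w + s • v) =
        vecMulVecForm g w w + 2 * s * vecMulVecForm g v w := by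
      simp only [map_add, map_smul, LinearMap.add_apply, LinearMap.smul_apply, hv,
        vecMulVecForm_comm hg w v, smul_eq_mul]
      ring
    rw [← h]
    exact hg _ (vecMulVec_self_mem_nonnegQuadraticForms _)
  by_contra hne
  rw [LinearMap.zero_apply] at hne
  -- This `s` makes the affine function equal to −1.
  have := key (-(vecMulVecForm g w w + 1) / (2 * vecMulVecForm g v w))
  field_simp at this
  linarith

/-! ### The slack of an inequality on deterministic boxes -/

/-- The slack of the inequality `B · P ≤ ω` on a deterministic box. -/
def slack (B : Box dA dB) (ω : ℝ) (δ : Strategy dA dB) : ℝ :=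
  ω - bellValue B (deterministicBox δ)

lemma bellValue_sum {ι : Type*} (s : Finset ι) (B : Box dA dB) (c : ι → ℝ)
    (P : ι → Box dA dB) :
    bellValue B (∑ i ∈ s, c i • P i) = ∑ i ∈ s, c i * bellValue B (P i) := by
  simp only [bellValue, Finset.sum_apply, Pi.smul_apply, smul_eq_mul, Finset.mul_sum]
  rw [Finset.sum_comm]
  exact Finset.sum_congr rfl fun i _ => Finset.sum_congr rfl fun e _ => by ring

lemma sum_mul_slack (B : Box dA dB) (ω : ℝ) (c : Strategy dA dB → ℝ) :
    ∑ δ, c δ * slack B ω δ =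
      ω * ∑ δ, c δ - bellValue B (∑ δ, c δ • deterministicBox δ) := by
  simp only [slack, mul_sub, Finset.sum_sub_distrib, bellValue_sum, ← Finset.sum_mul, mul_comm ω]

/-- Orthogonality permits replacing Γ(e,e) by Γ(e,1), which factorizes for a rank-one coefficient
matrix. -/
lemma slackFunctional_vecMulVec {B : Box dA dB} {ω : ℝ} {v w : Strategy dA dB → ℝ}
    (h : Matrix.vecMulVec v w ∈ orthogonalCoefficients dA dB) :
    slackFunctional B ω (Matrix.vecMulVec v w) = (∑ δ, v δ * slack B ω δ) * ∑ δ, w δ := by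
  rw [slackFunctional_apply, sum_mul_slack]
  simp only [← momentMatrix_some_none h, momentMatrix_vecMulVec, operatorValue, mul_one,
    bellValue, Finset.sum_apply, Pi.smul_apply, smul_eq_mul, ← mul_assoc, ← Finset.sum_mul]
  ring

lemma vecMulVec_single_mem (δ : Strategy dA dB) :
    Matrix.vecMulVec (Pi.single δ 1) (Pi.single δ 1) ∈ orthogonalCoefficients dA dB :=
  vecMulVec_mem_orthogonalCoefficients.2 fun e f h => by
    simpa [Pi.single_apply] using deterministicBox_mul_of_exclusive δ h

lemma sum_eq_zero_of_sum_smul_deterministicBox [Nonempty (Fin mA)] [Nonempty (Fin mB)]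
    {c : Strategy dA dB → ℝ} (hc : ∑ δ, c δ • deterministicBox δ = 0) : ∑ δ, c δ = 0 := by
  have x0 := Classical.arbitrary (Fin mA)
  have y0 := Classical.arbitrary (Fin mB)
  have h : ∀ δ : Strategy dA dB,
      ∑ p : Fin (dA x0) × Fin (dB y0), deterministicBox δ (⟨x0, p.1⟩, ⟨y0, p.2⟩) = 1 := fun δ => by
    rw [Fintype.sum_prod_type]
    exact (isNoSignalling_deterministicBox δ).normalized x0 y0
  calc ∑ δ, c δ = ∑ δ, ∑ p : Fin (dA x0) × Fin (dB y0),
        c δ * deterministicBox δ (⟨x0, p.1⟩, ⟨y0, p.2⟩) := by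
        simp only [← Finset.mul_sum, h, mul_one]
    _ = ∑ p : Fin (dA x0) × Fin (dB y0),
        (∑ δ, c δ • deterministicBox δ) (⟨x0, p.1⟩, ⟨y0, p.2⟩) := by
        rw [Finset.sum_comm]
        simp only [Finset.sum_apply, Pi.smul_apply, smul_eq_mul]
    _ = 0 := by simp only [hc, Pi.zero_apply, Finset.sum_const_zero]

/-- If no almost quantum box violates an inequality whose slack-free deterministic boxes span a
hyperplane, then its slack behaves like a multiple of a projector. -/
lemma slack_mul_slack [Nonempty (Fin mA)] [Nonempty (Fin mB)] {B : Box dA dB} {ω : ℝ}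
    (hQ : ∀ P ∈ almostQuantumSet dA dB, bellValue B P ≤ ω) {δ₀ : Strategy dA dB}
    (h₀ : slack B ω δ₀ ≠ 0)
    (hspan : ∀ δ, ∃ c : Strategy dA dB → ℝ, (∀ δ', c δ' ≠ 0 → slack B ω δ' = 0) ∧
      deterministicBox δ = (slack B ω δ / slack B ω δ₀) • deterministicBox δ₀ +
        ∑ δ', c δ' • deterministicBox δ')
    {v w : Strategy dA dB → ℝ} (h : Matrix.vecMulVec v w ∈ orthogonalCoefficients dA dB) :
    (∑ δ, v δ * slack B ω δ) * (∑ δ, w δ * slack B ω δ) =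
      slack B ω δ₀ * ((∑ δ, v δ * slack B ω δ) * ∑ δ, w δ) := by
  obtain ⟨g, hg, hpos⟩ := exists_extension_slackFunctional hQ
  set κ := slack B ω δ₀ with hκ
  set G := vecMulVecForm g
  have hdiag : ∀ δ, G (Pi.single δ 1) (Pi.single δ 1) = slack B ω δ := fun δ => by
    rw [vecMulVecForm_apply, hg _ (vecMulVec_single_mem δ),
      slackFunctional_vecMulVec (vecMulVec_single_mem δ)]
    simp [Pi.single_apply]
  have hR1 : ∀ δ, slack B ω δ = 0 → Pi.single δ 1 ∈ LinearMap.ker G := fun δ hδ =>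
    mem_ker_vecMulVecForm hpos ((hdiag δ).trans hδ)
  -- The moments of a linear relation vanish, so its product with any `u` satisfies the
  -- orthogonality constraints and `g` is given there by the slack functional, which is zero.
  have hR2 : ∀ c : Strategy dA dB → ℝ, ∑ δ, c δ • deterministicBox δ = 0 →
      c ∈ LinearMap.ker G := fun c hc => by
    refine LinearMap.mem_ker.2 (LinearMap.ext fun u => ?_)
    have hmem : Matrix.vecMulVec c u ∈ orthogonalCoefficients dA dB :=
      vecMulVec_mem_orthogonalCoefficients.2 fun e f _ => by
        have := congrFun hc e
        simp only [Finset.sum_apply, Pi.smul_apply, smul_eq_mul, Pi.zero_apply] at this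
        rw [this, zero_mul]
    rw [vecMulVecForm_apply, hg _ hmem, slackFunctional_vecMulVec hmem, sum_mul_slack, hc,
      sum_eq_zero_of_sum_smul_deterministicBox hc]
    simp [bellValue]
  have hR3 : ∀ δ, Pi.single δ 1 - (slack B ω δ / κ) • Pi.single δ₀ 1 ∈ LinearMap.ker G := by
    intro δ
    obtain ⟨c, hc, hδ⟩ := hspan δ
    have hc' : c ∈ LinearMap.ker G := by
      rw [pi_eq_sum_univ' c]
      refine sum_mem fun δ' _ => ?_
      by_cases h0 : c δ' = 0
      · rw [h0, zero_smul]; exact zero_mem _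
      · convert Submodule.smul_mem _ (c δ') (hR1 δ' (hc δ' h0)) using 2
    have hrest : (Pi.single δ 1 - (slack B ω δ / κ) • Pi.single δ₀ 1 - c :
        Strategy dA dB → ℝ) ∈ LinearMap.ker G := hR2 _ (by
      simp only [Pi.sub_apply, Pi.smul_apply, sub_smul, Finset.sum_sub_distrib, smul_eq_mul,
        mul_smul, ← Finset.smul_sum]
      have hs : ∀ δ₁ : Strategy dA dB, ∑ δ', (Pi.single δ₁ (1 : ℝ) : Strategy dA dB → ℝ) δ' •
          deterministicBox δ' = deterministicBox δ₁ := fun δ₁ => by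
        simp [Pi.single_apply]
      rw [hs, hs, hδ]
      abel)
    simpa using add_mem hrest hc'
  -- Modulo the radical every strategy is a multiple of `δ₀`, so G has rank one.
  have hR4 : ∀ u : Strategy dA dB → ℝ,
      G u = ((∑ δ, u δ * slack B ω δ) / κ) • G (Pi.single δ₀ 1) := fun u => by
    have hu : u = ∑ δ, u δ • (Pi.single δ 1 : Strategy dA dB → ℝ) := by
      funext i; simp [Pi.single_apply]
    conv_lhs => rw [hu, map_sum]
    rw [Finset.sum_div, Finset.sum_smul]
    refine Finset.sum_congr rfl fun δ _ => ?_
    have := LinearMap.mem_ker.1 (hR3 δ)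
    rw [map_sub, sub_eq_zero, map_smul] at this
    rw [map_smul, this, smul_smul, mul_div_assoc]
  have h1 : G v w = (∑ δ, v δ * slack B ω δ) * ∑ δ, w δ := by
    rw [vecMulVecForm_apply, hg _ h, slackFunctional_vecMulVec h]
  rw [hR4 v, LinearMap.smul_apply, vecMulVecForm_comm hpos, hR4 w, LinearMap.smul_apply, hdiag,
    smul_eq_mul, smul_eq_mul, ← hκ, div_mul_cancel₀ _ h₀] at h1
  rw [← h1]
  field_simp

/-! ### Functions of two strategies -/

section Strategies

variable {ι κ : Type*} [DecidableEq ι] [DecidableEq κ] {π : ι → Type*} {ρ : κ → Type*}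

lemma eq_of_update_eq {X : Type*} {f : (∀ i, π i) → X} (s : Finset ι)
    (hf : ∀ i ∈ s, ∀ α a, f (Function.update α i a) = f α) {α α' : ∀ i, π i}
    (h : ∀ i ∉ s, α i = α' i) : f α = f α' := by
  induction s using Finset.induction_on generalizing α with
  | empty => exact congrArg f (funext fun i => h i (Finset.notMem_empty i))
  | insert i s _ ih =>
    rw [← hf i (Finset.mem_insert_self i s) α (α' i)]
    refine ih (fun j hj => hf j (Finset.mem_insert_of_mem hj)) fun j hj => ?_
    by_cases hij : j = i
    · subst hij; simp
    · rw [Function.update_of_ne hij]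
      exact h j (by simp [hij, hj])

/-- By `hmixed` the effect of changing a coordinate other than `x` is the same for all `β`. At a `β`
where `f` depends on `x`, `hA` makes this effect zero. -/
lemma update_eq_of_mixed_difference_eq_zero [Fintype κ] {f : (∀ i, π i) → (∀ k, ρ k) → ℝ} {x : ι}
    (hA : ∀ β x x', x ≠ x' → ∀ α a α' a', (f (Function.update α x a) β - f α β) *
      (f (Function.update α' x' a') β - f α' β) = 0)
    (hmixed : ∀ x' ≠ x, ∀ y α a β b,
      f (Function.update α x' a) (Function.update β y b) - f α (Function.update β y b) =
        f (Function.update α x' a) β - f α β)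
    (hdep : ∃ α a β, f (Function.update α x a) β ≠ f α β) :
    ∀ x' ≠ x, ∀ α a β, f (Function.update α x' a) β = f α β := by
  intro x' hx' α' a' β'
  obtain ⟨α, a, β, h⟩ := hdep
  have hconst : f (Function.update α' x' a') β - f α' β =
      f (Function.update α' x' a') β' - f α' β' :=
    eq_of_update_eq (f := fun β => f (Function.update α' x' a') β - f α' β) Finset.univ
      (fun y _ β b => hmixed x' hx' y α' a' β b) (by simp)
  have h0 := (mul_eq_zero.1 (hA β x x' hx'.symm α a α' a')).resolve_left (sub_ne_zero.2 h)
  rw [hconst] at h0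
  exact sub_eq_zero.1 h0

/-- If `f α β` depends on at most one coordinate of each argument when the other one is fixed,
and mixed differences in disjoint pairs of coordinates have product zero, then one of the
arguments enters `f` through one coordinate only. -/
lemma depends_on_one_coordinate [Fintype ι] [Fintype κ] [Nonempty ι]
    {f : (∀ i, π i) → (∀ k, ρ k) → ℝ}
    (hA : ∀ β x x', x ≠ x' → ∀ α a α' a', (f (Function.update α x a) β - f α β) *
      (f (Function.update α' x' a') β - f α' β) = 0)
    (hB : ∀ α y y', y ≠ y' → ∀ β b β' b', (f α (Function.update β y b) - f α β) *
      (f α (Function.update β' y' b') - f α β') = 0)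
    (hAB : ∀ x x', x ≠ x' → ∀ y y', y ≠ y' → ∀ α a β b α' a' β' b',
      (f (Function.update α x a) (Function.update β y b) - f α (Function.update β y b) -
        (f (Function.update α x a) β - f α β)) *
      (f (Function.update α' x' a') (Function.update β' y' b') - f α' (Function.update β' y' b') -
        (f (Function.update α' x' a') β' - f α' β')) = 0) :
    (∃ x, ∀ x' ≠ x, ∀ α a β, f (Function.update α x' a) β = f α β) ∨
      ∃ y, ∀ y' ≠ y, ∀ β b α, f α (Function.update β y' b) = f α β := by
  by_cases hM : ∀ x y α a β b, f (Function.update α x a) (Function.update β y b) -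
      f α (Function.update β y b) = f (Function.update α x a) β - f α β
  · left
    by_cases hdep : ∃ x α a β, f (Function.update α x a) β ≠ f α β
    · obtain ⟨x, hx⟩ := hdep
      exact ⟨x, update_eq_of_mixed_difference_eq_zero hA (fun x' _ => hM x') hx⟩
    · push Not at hdep
      exact ⟨Classical.arbitrary ι, fun x' _ => hdep x'⟩
  · push Not at hM
    obtain ⟨x, y, α, a, β, b, hxy⟩ := hM
    -- By `hAB`, any two positions (x, y) carrying a non-zero mixed difference share a row or a
    -- column. Such a set of positions lies in a single row or in a single column.
    by_cases hrow : ∀ x' ≠ x, ∀ y α a β b,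
        f (Function.update α x' a) (Function.update β y b) - f α (Function.update β y b) =
          f (Function.update α x' a) β - f α β
    · left
      refine ⟨x, update_eq_of_mixed_difference_eq_zero hA hrow ?_⟩
      by_contra! h
      exact hxy (by rw [h, h, sub_self, sub_self])
    · right
      push Not at hrow
      obtain ⟨x', hx', y', α', a', β', b', hxy'⟩ := hrow
      obtain rfl : y' = y := by
        by_contra hne
        exact mul_ne_zero (sub_ne_zero.2 hxy) (sub_ne_zero.2 hxy')
          (hAB x x' hx'.symm y y' (Ne.symm hne) _ _ _ _ _ _ _ _)
      refine ⟨y', fun y'' hy'' β₁ b₁ α₁ => update_eq_of_mixed_difference_eq_zero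
        (f := fun β α => f α β) (fun α => hB α) ?_ ?_ y'' hy'' β₁ b₁ α₁⟩
      · intro y₁ hy₁ x₁ β₁ b₁ α₁ a₁
        by_contra h
        have hne : f (Function.update α₁ x₁ a₁) (Function.update β₁ y₁ b₁) -
            f α₁ (Function.update β₁ y₁ b₁) - (f (Function.update α₁ x₁ a₁) β₁ - f α₁ β₁) ≠ 0 :=
          fun h' => h (by linarith)
        -- The column `y'` already contains non-zero positions in the two rows `x` and `x'`. A
        -- position outside the column differs in row from at least one of them, contradicting
        -- `hAB`.
        by_cases hx₁ : x₁ = x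
        · subst hx₁
          exact mul_ne_zero hne (sub_ne_zero.2 hxy')
            (hAB _ _ hx'.symm _ _ hy₁ _ _ _ _ _ _ _ _)
        · exact mul_ne_zero hne (sub_ne_zero.2 hxy) (hAB _ _ hx₁ _ _ hy₁ _ _ _ _ _ _ _ _)
      · by_contra! h
        exact hxy (by
          have h1 := h β b (Function.update α x a)
          have h2 := h β b α
          linarith)

end Strategies

/-- With `α` fixed, `hB` leaves at most one relevant input of Bob, and this input may vary with
Alice's answer `a` to `x`. So `f` is a non-negative combination of indicators of α(x) = a, β(y(a)) =
b, on each of which `c` is non-negative by `hc`. -/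
lemma sum_mul_nonneg_of_depends_on_one_coordinate [Nonempty (Fin mB)]
    {f : (∀ x, Fin (dA x)) → (∀ y, Fin (dB y)) → ℝ} (hf : ∀ α β, 0 ≤ f α β) {x : Fin mA}
    (hx : ∀ x' ≠ x, ∀ α a β, f (Function.update α x' a) β = f α β)
    (hB : ∀ α y y', y ≠ y' → ∀ β b β' b', (f α (Function.update β y b) - f α β) *
      (f α (Function.update β' y' b') - f α β') = 0)
    {c : Strategy dA dB → ℝ}
    (hc : ∀ u v, 0 ≤ ∑ δ : Strategy dA dB, c δ * (response δ.1 u * response δ.2 v)) :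
    0 ≤ ∑ δ, c δ * f δ.1 δ.2 := by
  by_cases hne : Nonempty (Strategy dA dB)
  swap
  · rw [not_nonempty_iff] at hne
    simp
  obtain ⟨α₀, β₀⟩ := hne
  have hy : ∀ a : Fin (dA x), ∃ y, ∀ y' ≠ y, ∀ β b,
      f (Function.update α₀ x a) (Function.update β y' b) = f (Function.update α₀ x a) β := by
    intro a
    by_cases hdep : ∃ y β b,
        f (Function.update α₀ x a) (Function.update β y b) ≠ f (Function.update α₀ x a) β
    · obtain ⟨y, β, b, h⟩ := hdep
      exact ⟨y, fun y' hy' β' b' => sub_eq_zero.1 ((mul_eq_zero.1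
        (hB (Function.update α₀ x a) y y' hy'.symm β b β' b')).resolve_left (sub_ne_zero.2 h))⟩
    · push Not at hdep
      exact ⟨Classical.arbitrary _, fun y' _ => hdep y'⟩
  choose y hy using hy
  have hform : ∀ α β, f α β = ∑ a, ∑ b, f (Function.update α₀ x a) (Function.update β₀ (y a) b) *
      (response α ⟨x, a⟩ * response β ⟨y a, b⟩) := by
    intro α β
    have h1 : f α β = f (Function.update α₀ x (α x)) β :=
      eq_of_update_eq (f := fun α => f α β) (Finset.univ.erase x)
        (fun x' hx' α a => hx x' (Finset.ne_of_mem_erase hx') α a β) (by simp)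
    have h2 : f (Function.update α₀ x (α x)) β = f (Function.update α₀ x (α x))
        (Function.update β₀ (y (α x)) (β (y (α x)))) :=
      eq_of_update_eq (Finset.univ.erase (y (α x)))
        (fun y' hy' β b => hy (α x) y' (Finset.ne_of_mem_erase hy') β b) (by simp)
    rw [h1, h2]
    simp [response]
  have hsum : ∑ δ, c δ * f δ.1 δ.2 =
      ∑ a, ∑ b, f (Function.update α₀ x a) (Function.update β₀ (y a) b) *
        ∑ δ : Strategy dA dB, c δ * (response δ.1 ⟨x, a⟩ * response δ.2 ⟨y a, b⟩) := by
    simp only [Finset.mul_sum]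
    calc _ = ∑ δ : Strategy dA dB, ∑ a, ∑ b,
          f (Function.update α₀ x a) (Function.update β₀ (y a) b) *
            (c δ * (response δ.1 ⟨x, a⟩ * response δ.2 ⟨y a, b⟩)) :=
          Finset.sum_congr rfl fun δ _ => by
            rw [hform δ.1 δ.2]
            simp only [Finset.mul_sum]
            exact Finset.sum_congr rfl fun a _ => Finset.sum_congr rfl fun b _ => by ring
      _ = _ := by
          rw [Finset.sum_comm]
          exact Finset.sum_congr rfl fun a _ => Finset.sum_comm
  rw [hsum]
  exact Finset.sum_nonneg fun a _ => Finset.sum_nonneg fun b _ => mul_nonneg (hf _ _) (hc _ _)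

/-! ### Product tests of the slack -/

/-- The difference of two strategies that differ in the answer to the input `x`. -/
def strategyDifference {m : ℕ} {d : Fin m → ℕ} (α : ∀ x, Fin (d x)) (x : Fin m)
    (a : Fin (d x)) : (∀ x, Fin (d x)) → ℝ :=
  Pi.single (Function.update α x a) 1 - Pi.single α 1

/-- The pairs of vectors of strategies whose product annihilates locally exclusive events. -/
def LocallyOrthogonal {m : ℕ} {d : Fin m → ℕ} (v w : (∀ x, Fin (d x)) → ℝ) : Prop :=
  ∀ u u', LocallyExclusive u u' →
    (∑ α, v α * response α u) * (∑ α, w α * response α u') = 0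

lemma locallyOrthogonal_single {m : ℕ} {d : Fin m → ℕ} (α : ∀ x, Fin (d x)) :
    LocallyOrthogonal (Pi.single α 1) (Pi.single α 1) := fun u u' h => by
  simpa [Pi.single_apply] using response_mul_response_of_ne α h.1 h.2

lemma sum_strategyDifference_mul {m : ℕ} {d : Fin m → ℕ} (α : ∀ x, Fin (d x)) (x : Fin m)
    (a : Fin (d x)) (F : (∀ x, Fin (d x)) → ℝ) :
    ∑ α', strategyDifference α x a α' * F α' = F (Function.update α x a) - F α := by
  simp [strategyDifference, Pi.single_apply, sub_mul, Finset.sum_sub_distrib]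

lemma sum_strategyDifference {m : ℕ} {d : Fin m → ℕ} (α : ∀ x, Fin (d x)) (x : Fin m)
    (a : Fin (d x)) : ∑ α', strategyDifference α x a α' = 0 := by
  simpa using sum_strategyDifference_mul α x a fun _ => 1

/-- The responses of the two differences are supported on the inputs `x` and `x'`, whereas exclusive
events share an input. -/
lemma locallyOrthogonal_strategyDifference {m : ℕ} {d : Fin m → ℕ} {x x' : Fin m} (h : x ≠ x')
    (α : ∀ x, Fin (d x)) (a : Fin (d x)) (α' : ∀ x, Fin (d x)) (a' : Fin (d x')) :
    LocallyOrthogonal (strategyDifference α x a) (strategyDifference α' x' a') := by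
  intro u u' hu
  rw [sum_strategyDifference_mul, sum_strategyDifference_mul]
  by_cases hx : u.1 = x
  · rw [response_update_of_ne α' x' a' (u := u') (by rw [← hu.1, hx]; exact h), sub_self, mul_zero]
  · rw [response_update_of_ne α x a hx, sub_self, zero_mul]

lemma vecMulVec_product_mem {vA wA : (∀ x, Fin (dA x)) → ℝ} {vB wB : (∀ y, Fin (dB y)) → ℝ}
    (hA : LocallyOrthogonal vA wA) (hB : LocallyOrthogonal vB wB) :
    Matrix.vecMulVec (fun δ : Strategy dA dB => vA δ.1 * vB δ.2)
      (fun δ : Strategy dA dB => wA δ.1 * wB δ.2) ∈ orthogonalCoefficients dA dB := by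
  have key : ∀ (v : (∀ x, Fin (dA x)) → ℝ) (w : (∀ y, Fin (dB y)) → ℝ) (e : BellEvent dA dB),
      ∑ δ : Strategy dA dB, v δ.1 * w δ.2 * deterministicBox δ e =
        (∑ α, v α * response α e.1) * ∑ β, w β * response β e.2 := fun v w e => by
    rw [Finset.sum_mul_sum, Fintype.sum_prod_type]
    exact Finset.sum_congr rfl fun α _ => Finset.sum_congr rfl fun β _ => by
      simp only [deterministicBox]; ring
  rw [vecMulVec_mem_orthogonalCoefficients]
  intro e f h
  rw [key, key, mul_mul_mul_comm]
  rcases h with h | h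
  · rw [hA _ _ h, zero_mul]
  · rw [hB _ _ h, mul_zero]

lemma sum_product_mul (vA : (∀ x, Fin (dA x)) → ℝ) (vB : (∀ y, Fin (dB y)) → ℝ)
    (F : Strategy dA dB → ℝ) :
    ∑ δ : Strategy dA dB, vA δ.1 * vB δ.2 * F δ = ∑ α, vA α * ∑ β, vB β * F (α, β) := by
  simp only [Fintype.sum_prod_type, Finset.mul_sum, mul_assoc]

/-- An inequality whose slack behaves like a multiple of a projector is valid for all
no-signalling boxes. -/
lemma bellValue_le_of_slack_mul_slack [Nonempty (Fin mA)] [Nonempty (Fin mB)] {B : Box dA dB}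
    {ω κ : ℝ} (hslack : ∀ δ, 0 ≤ slack B ω δ) (δ₀ : Strategy dA dB)
    (hproj : ∀ v w : Strategy dA dB → ℝ,
      Matrix.vecMulVec v w ∈ orthogonalCoefficients dA dB →
      (∑ δ, v δ * slack B ω δ) * (∑ δ, w δ * slack B ω δ) =
        κ * ((∑ δ, v δ * slack B ω δ) * ∑ δ, w δ))
    {P : Box dA dB} (hP : IsNoSignalling P) : bellValue B P ≤ ω := by
  have hsum : ∀ (vA : (∀ x, Fin (dA x)) → ℝ) (vB : (∀ y, Fin (dB y)) → ℝ),
      ∑ δ : Strategy dA dB, vA δ.1 * vB δ.2 = (∑ α, vA α) * ∑ β, vB β := fun vA vB => by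
    rw [Finset.sum_mul_sum, Fintype.sum_prod_type]
  -- A strategy difference has total weight zero, so the right-hand side of `hproj` vanishes here
  -- and in `hB` and `hAB`.
  have hA : ∀ β x x', x ≠ x' → ∀ α a α' a',
      (slack B ω (Function.update α x a, β) - slack B ω (α, β)) *
        (slack B ω (Function.update α' x' a', β) - slack B ω (α', β)) = 0 := by
    intro β x x' h α a α' a'
    have := hproj _ _ (vecMulVec_product_mem (locallyOrthogonal_strategyDifference h α a α' a')
      (locallyOrthogonal_single β))
    rw [hsum, sum_strategyDifference, zero_mul, mul_zero, mul_zero, sum_product_mul,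
      sum_product_mul, sum_strategyDifference_mul, sum_strategyDifference_mul] at this
    simpa [Pi.single_apply] using this
  have hB : ∀ α y y', y ≠ y' → ∀ β b β' b',
      (slack B ω (α, Function.update β y b) - slack B ω (α, β)) *
        (slack B ω (α, Function.update β' y' b') - slack B ω (α, β')) = 0 := by
    intro α y y' h β b β' b'
    have := hproj _ _ (vecMulVec_product_mem (locallyOrthogonal_single α)
      (locallyOrthogonal_strategyDifference h β b β' b'))
    rw [hsum, sum_strategyDifference, mul_zero, mul_zero, mul_zero, sum_product_mul,
      sum_product_mul] at this
    simp only [sum_strategyDifference_mul] at this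
    simpa [Pi.single_apply] using this
  have hAB : ∀ x x', x ≠ x' → ∀ y y', y ≠ y' → ∀ α a β b α' a' β' b',
      (slack B ω (Function.update α x a, Function.update β y b) -
        slack B ω (α, Function.update β y b) -
        (slack B ω (Function.update α x a, β) - slack B ω (α, β))) *
      (slack B ω (Function.update α' x' a', Function.update β' y' b') -
        slack B ω (α', Function.update β' y' b') -
        (slack B ω (Function.update α' x' a', β') - slack B ω (α', β'))) = 0 := by
    intro x x' hx y y' hy α a β b α' a' β' b'
    have := hproj _ _ (vecMulVec_product_mem (locallyOrthogonal_strategyDifference hx α a α' a')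
      (locallyOrthogonal_strategyDifference hy β b β' b'))
    rw [hsum, sum_strategyDifference, zero_mul, mul_zero, mul_zero, sum_product_mul,
      sum_product_mul, sum_strategyDifference_mul, sum_strategyDifference_mul] at this
    simp only [sum_strategyDifference_mul] at this
    rw [← this]
    ring
  -- The coefficients may be negative; only the sums giving the entries of `P` are known to be
  -- non-negative.
  obtain ⟨c, hc1, hcP⟩ := hP.exists_affine_combination δ₀
  have hval : ω - bellValue B P = ∑ δ, c δ * slack B ω δ := by
    rw [sum_mul_slack, hc1, hcP, mul_one]
  have hcnn : ∀ u v, 0 ≤ ∑ δ : Strategy dA dB, c δ * (response δ.1 u * response δ.2 v) :=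
    fun u v => by
      have h := hP.nonneg (u, v)
      rw [← hcP] at h
      simpa [deterministicBox] using h
  rw [← sub_nonneg, hval]
  rcases depends_on_one_coordinate (f := fun α β => slack B ω (α, β)) hA hB hAB with
    ⟨x, hx⟩ | ⟨y, hy⟩
  · exact sum_mul_nonneg_of_depends_on_one_coordinate (f := fun α β => slack B ω (α, β))
      (fun _ _ => hslack _) hx hB hcnn
  · have h := sum_mul_nonneg_of_depends_on_one_coordinate (f := fun β α => slack B ω (α, β))
      (c := fun δ => c δ.swap) (fun _ _ => hslack _) hy hA fun v u => by
        have := hcnn u v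
        rw [← (Equiv.prodComm _ _).sum_comp] at this
        simpa [mul_comm] using this
    rw [← (Equiv.prodComm _ _).sum_comp]
    exact h

/-! ### Faces of the classical and of the no-signalling polytope -/

lemma classicalPolytope_eq [Nonempty (Fin mA)] [Nonempty (Fin mB)] :
    classicalPolytope dA dB = convexHull ℝ (Set.range deterministicBox) :=
  congrArg (convexHull ℝ) (Set.Subset.antisymm (fun _ hP => exists_deterministicBox_eq hP)
    (Set.range_subset_iff.2 deterministicBox_mem))

lemma deterministicBox_mem_classicalPolytope (δ : Strategy dA dB) :
    deterministicBox δ ∈ classicalPolytope dA dB :=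
  subset_convexHull ℝ _ (deterministicBox_mem δ)

lemma convex_noSignallingPolytope : Convex ℝ (noSignallingPolytope dA dB) := by
  intro P hP R hR s t hs ht hst
  refine ⟨fun e => ?_, fun x y => ?_, fun x x' y b => ?_, fun y y' x a => ?_⟩
  · exact add_nonneg (mul_nonneg hs (hP.nonneg e)) (mul_nonneg ht (hR.nonneg e))
  · simp only [Pi.add_apply, Pi.smul_apply, smul_eq_mul, Finset.sum_add_distrib, ← Finset.mul_sum,
      hP.normalized, hR.normalized, mul_one, hst]
  · simp only [Pi.add_apply, Pi.smul_apply, smul_eq_mul, Finset.sum_add_distrib, ← Finset.mul_sum,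
      hP.noSignalling_to_Bob x x', hR.noSignalling_to_Bob x x']
  · simp only [Pi.add_apply, Pi.smul_apply, smul_eq_mul, Finset.sum_add_distrib, ← Finset.mul_sum,
      hP.noSignalling_to_Alice y y', hR.noSignalling_to_Alice y y']

lemma classicalPolytope_subset : classicalPolytope dA dB ⊆ noSignallingPolytope dA dB :=
  convexHull_min (fun _ hP => hP.1) convex_noSignallingPolytope

lemma exists_convex_combination [Nonempty (Fin mA)] [Nonempty (Fin mB)] {P : Box dA dB}
    (hP : P ∈ classicalPolytope dA dB) : ∃ c : Strategy dA dB → ℝ,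
      (∀ δ, 0 ≤ c δ) ∧ ∑ δ, c δ = 1 ∧ ∑ δ, c δ • deterministicBox δ = P := by
  rw [classicalPolytope_eq, convexHull_range_eq_exists_affineCombination] at hP
  obtain ⟨s, w, hw0, hw1, rfl⟩ := hP
  refine ⟨fun δ => if δ ∈ s then w δ else 0, fun δ => ?_, ?_, ?_⟩
  · dsimp only
    split_ifs with h
    exacts [hw0 δ h, le_rfl]
  · simpa using hw1
  · rw [Finset.affineCombination_eq_linear_combination _ _ _ hw1]
    simp [ite_smul]

lemma affineSpan_noSignallingPolytope [Nonempty (Fin mA)] [Nonempty (Fin mB)]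
    (δ₀ : Strategy dA dB) :
    affineSpan ℝ (noSignallingPolytope dA dB) = affineSpan ℝ (classicalPolytope dA dB) := by
  refine le_antisymm (affineSpan_le.2 fun P hP => ?_)
    (affineSpan_mono ℝ classicalPolytope_subset)
  obtain ⟨c, hc1, rfl⟩ := IsNoSignalling.exists_affine_combination δ₀ hP
  rw [← Finset.affineCombination_eq_linear_combination _ _ _ hc1]
  exact affineSpan_mono ℝ (Set.range_subset_iff.2 deterministicBox_mem_classicalPolytope)
    (affineCombination_mem_affineSpan hc1 _)

/-- The Bell expression as a linear map. -/
def bellFunctional (B : Box dA dB) : Box dA dB →ₗ[ℝ] ℝ where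
  toFun := bellValue B
  map_add' P R := by simp [bellValue, mul_add, Finset.sum_add_distrib]
  map_smul' c P := by simp [bellValue, Finset.mul_sum, mul_left_comm]

lemma bellFunctional_apply (B P : Box dA dB) : bellFunctional B P = bellValue B P := rfl

lemma direction_face_le (K : Set (Box dA dB)) (B : Box dA dB) (ω : ℝ) :
    (affineSpan ℝ (face K B ω)).direction ≤
      (affineSpan ℝ K).direction ⊓ LinearMap.ker (bellFunctional B) := by
  refine le_inf (AffineSubspace.direction_le (affineSpan_mono ℝ fun P hP => hP.1)) ?_
  rw [direction_affineSpan, vectorSpan_def, Submodule.span_le]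
  rintro _ ⟨P, hP, R, hR, rfl⟩
  change bellFunctional B (P - R) = 0
  rw [map_sub, bellFunctional_apply,
    bellFunctional_apply, hP.2, hR.2, sub_self]

/-- If an inequality is strict at some point of `K`, the dimension of its face is smaller
than that of `K`. -/
lemma finrank_inf_ker_lt {K : Set (Box dA dB)} {B : Box dA dB} {ω : ℝ} {P R : Box dA dB}
    (hP : P ∈ face K B ω) (hR : R ∈ K) (hne : bellValue B R ≠ ω) :
    Module.finrank ℝ ((affineSpan ℝ K).direction ⊓ LinearMap.ker (bellFunctional B) :
      Submodule ℝ (Box dA dB)) < affineDim K := by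
  refine Submodule.finrank_lt_finrank_of_lt (lt_of_le_of_ne inf_le_left fun h => ?_)
  have hmem : R - P ∈ (affineSpan ℝ K).direction :=
    AffineSubspace.vsub_mem_direction (mem_affineSpan ℝ hR) (mem_affineSpan ℝ hP.1)
  rw [← h] at hmem
  have := LinearMap.mem_ker.1 hmem.2
  rw [map_sub, bellFunctional_apply, bellFunctional_apply, hP.2] at this
  exact hne (sub_eq_zero.1 this)

lemma SupportsFacet.direction_eq {K : Set (Box dA dB)} {B : Box dA dB} {ω : ℝ}
    (h : SupportsFacet K B ω) {R : Box dA dB} (hR : R ∈ K) (hne : bellValue B R ≠ ω) :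
    (affineSpan ℝ (face K B ω)).direction =
      (affineSpan ℝ K).direction ⊓ LinearMap.ker (bellFunctional B) := by
  obtain ⟨P, hP⟩ := h.nonempty
  refine Submodule.eq_of_le_of_finrank_le (direction_face_le K B ω) ?_
  exact Nat.lt_succ_iff.1 ((finrank_inf_ker_lt hP hR hne).trans_eq h.dim.symm)

/-- The deterministic boxes on a facet of the classical polytope span a hyperplane. -/
lemma SupportsFacet.exists_combination [Nonempty (Fin mA)] [Nonempty (Fin mB)] {B : Box dA dB}
    {ω : ℝ} (h : SupportsFacet (classicalPolytope dA dB) B ω) {δ₀ : Strategy dA dB}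
    (h₀ : slack B ω δ₀ ≠ 0) (δ : Strategy dA dB) :
    ∃ c : Strategy dA dB → ℝ, (∀ δ', c δ' ≠ 0 → slack B ω δ' = 0) ∧
      deterministicBox δ = (slack B ω δ / slack B ω δ₀) • deterministicBox δ₀ +
        ∑ δ', c δ' • deterministicBox δ' := by
  set S : Submodule ℝ (Box dA dB) :=
    Submodule.span ℝ (deterministicBox '' {δ | slack B ω δ = 0}) with hS
  -- A convex combination on the face gives positive weight only to boxes of slack zero.
  have hface : face (classicalPolytope dA dB) B ω ⊆ S := by
    rintro P ⟨hP, hval⟩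
    obtain ⟨c, hc0, hc1, rfl⟩ := exists_convex_combination hP
    have hsum : ∑ δ, c δ * slack B ω δ = 0 := by
      rw [sum_mul_slack, hc1, hval, mul_one, sub_self]
    have hz := (Finset.sum_eq_zero_iff_of_nonneg fun δ _ => mul_nonneg (hc0 δ) (sub_nonneg.2
      (h.valid _ (deterministicBox_mem_classicalPolytope δ)))).1 hsum
    refine sum_mem fun δ' hδ' => ?_
    rcases mul_eq_zero.1 (hz δ' hδ') with h' | h'
    · rw [h', zero_smul]; exact zero_mem _
    · exact Submodule.smul_mem _ _ (Submodule.subset_span ⟨δ', h', rfl⟩)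
  have hdir : (affineSpan ℝ (face (classicalPolytope dA dB) B ω)).direction ≤ S := by
    rw [direction_affineSpan, vectorSpan_def, Submodule.span_le]
    rintro _ ⟨P, hP, R, hR, rfl⟩
    exact sub_mem (hface hP) (hface hR)
  rw [h.direction_eq (deterministicBox_mem_classicalPolytope δ₀)
    (fun h' => h₀ (sub_eq_zero.2 h'.symm))] at hdir
  obtain ⟨P, hP⟩ := h.nonempty
  have hsub : ∀ δ', deterministicBox δ' - P ∈
      (affineSpan ℝ (classicalPolytope dA dB)).direction := fun δ' =>
    AffineSubspace.vsub_mem_direction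
      (mem_affineSpan ℝ (deterministicBox_mem_classicalPolytope δ')) (mem_affineSpan ℝ hP.1)
  set r := slack B ω δ / slack B ω δ₀ with hr
  -- The ratio `r` is the one for which the Bell functional vanishes on this vector, which then lies
  -- in the direction of the facet.
  have hker : (deterministicBox δ - P) - r • (deterministicBox δ₀ - P) ∈ S := by
    refine hdir ⟨sub_mem (hsub δ) (Submodule.smul_mem _ _ (hsub δ₀)), ?_⟩
    rw [SetLike.mem_coe, LinearMap.mem_ker]
    simp only [map_sub, map_smul, bellFunctional_apply, hP.2, smul_eq_mul]
    have hmul : r * slack B ω δ₀ = slack B ω δ := div_mul_cancel₀ _ h₀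
    simp only [slack] at hmul
    linarith
  -- The base point drops out because `S` is a linear span that contains `P`.
  have hmem : deterministicBox δ - r • deterministicBox δ₀ ∈ S := by
    have := add_mem hker (sub_mem (hface hP) (Submodule.smul_mem _ r (hface hP)))
    convert this using 1
    rw [smul_sub]
    abel
  rw [hS, Submodule.mem_span_image_iff_exists_fun] at hmem
  obtain ⟨t, ht, c, hc⟩ := hmem
  classical
  refine ⟨fun δ' => if hδ' : δ' ∈ t then c ⟨δ', hδ'⟩ else 0, fun δ' hne => ?_, ?_⟩
  · by_cases hδ' : δ' ∈ t
    · exact ht hδ'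
    · simp [hδ'] at hne
  · rw [← sub_eq_iff_eq_add', ← hc, ← Finset.sum_subset (Finset.subset_univ t),
      ← Finset.sum_coe_sort t]
    · exact Finset.sum_congr rfl fun i _ => by beta_reduce; rw [dif_pos i.2]
    · intro δ' _ hδ'
      simp [hδ']

/-- A facet of the classical polytope that is valid for all no-signalling boxes is a facet of the
no-signalling polytope. -/
lemma SupportsFacet.noSignalling [Nonempty (Fin mA)] [Nonempty (Fin mB)] {B : Box dA dB}
    {ω : ℝ} (h : SupportsFacet (classicalPolytope dA dB) B ω) {δ₀ : Strategy dA dB}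
    (h₀ : slack B ω δ₀ ≠ 0) (hvalid : ∀ P ∈ noSignallingPolytope dA dB, bellValue B P ≤ ω) :
    SupportsFacet (noSignallingPolytope dA dB) B ω := by
  have hne : bellValue B (deterministicBox δ₀) ≠ ω := fun h' => h₀ (sub_eq_zero.2 h'.symm)
  have hmem := deterministicBox_mem_classicalPolytope δ₀
  have hsub : face (classicalPolytope dA dB) B ω ⊆ face (noSignallingPolytope dA dB) B ω :=
    fun P hP => ⟨classicalPolytope_subset hP.1, hP.2⟩
  refine ⟨hvalid, h.nonempty.mono hsub, fun heq => ?_, ?_⟩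
  · have : deterministicBox δ₀ ∈ face (noSignallingPolytope dA dB) B ω := by
      rw [heq]; exact classicalPolytope_subset hmem
    exact hne this.2
  · have hdir : (affineSpan ℝ (face (noSignallingPolytope dA dB) B ω)).direction =
        (affineSpan ℝ (face (classicalPolytope dA dB) B ω)).direction := by
      refine le_antisymm ?_ (AffineSubspace.direction_le (affineSpan_mono ℝ hsub))
      rw [h.direction_eq hmem hne, ← affineSpan_noSignallingPolytope δ₀]
      exact direction_face_le _ _ _
    have := h.dim
    unfold affineDim at this ⊢
    rwa [hdir, affineSpan_noSignallingPolytope δ₀]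

/-- Without events the space of boxes is trivial, while a set with a facet has dimension at least
one. -/
lemma SupportsFacet.nonempty_bellEvent {K : Set (Box dA dB)} {B : Box dA dB} {ω : ℝ}
    (h : SupportsFacet K B ω) : Nonempty (BellEvent dA dB) := by
  by_contra hempty
  rw [not_nonempty_iff] at hempty
  have hdim := h.dim
  have h0 : affineDim K = 0 := Module.finrank_zero_of_subsingleton
  omega

lemma SupportsFacet.exists_slack_ne_zero [Nonempty (Fin mA)] [Nonempty (Fin mB)] {B : Box dA dB}
    {ω : ℝ} (h : SupportsFacet (classicalPolytope dA dB) B ω) : ∃ δ, slack B ω δ ≠ 0 := by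
  by_contra! hz
  refine h.proper (Set.Subset.antisymm (fun P hP => hP.1) fun P hP => ⟨hP, ?_⟩)
  obtain ⟨c, -, hc1, rfl⟩ := exists_convex_combination hP
  have := sum_mul_slack B ω c
  simp only [hz, mul_zero, Finset.sum_const_zero, hc1, mul_one] at this
  linarith

lemma bddAbove_bellValue_almostQuantumSet (B : Box dA dB) :
    BddAbove (bellValue B '' almostQuantumSet dA dB) := by
  refine ⟨∑ e, |B e|, ?_⟩
  rintro _ ⟨P, hP, rfl⟩
  refine Finset.sum_le_sum fun e _ => (le_abs_self _).trans ?_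
  rw [abs_mul, abs_of_nonneg (hP.1.nonneg e)]
  exact mul_le_of_le_one_right (abs_nonneg _) (hP.1.le_one e)

theorem mainTheorem1 (mA mB : ℕ) (dA : Fin mA → ℕ) (dB : Fin mB → ℕ)
    (q : Fin mA → Fin mB → ℝ) (V : BellEvent dA dB → ℝ) (B : Box dA dB)
    (hB : ∀ e, B e = q e.1.1 e.2.1 * V e) (ωc : ℝ)
    (hfacet : IsFacetBellInequality B ωc) :
    IsGreatest (bellValue B '' classicalPolytope dA dB) ωc ∧
      ωc = classicalValue B ∧
      IsLUB (bellValue B '' almostQuantumSet dA dB) (almostQuantumValue B) ∧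
      ωc < almostQuantumValue B := by
  obtain ⟨e⟩ := hfacet.facet.nonempty_bellEvent
  have : Nonempty (Fin mA) := ⟨e.1.1⟩
  have : Nonempty (Fin mB) := ⟨e.2.1⟩
  have hgreatest : IsGreatest (bellValue B '' classicalPolytope dA dB) ωc := by
    obtain ⟨P, hP, hval⟩ := hfacet.facet.nonempty
    exact ⟨⟨P, hP, hval⟩, by rintro _ ⟨R, hR, rfl⟩; exact hfacet.facet.valid R hR⟩
  obtain ⟨δ₀, h₀⟩ := hfacet.facet.exists_slack_ne_zero
  refine ⟨hgreatest, hgreatest.csSup_eq.symm, isLUB_csSup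
    ⟨_, deterministicBox δ₀, deterministicBox_mem_almostQuantumSet δ₀, rfl⟩
    (bddAbove_bellValue_almostQuantumSet B), ?_⟩
  by_contra hle
  have hQ : ∀ P ∈ almostQuantumSet dA dB, bellValue B P ≤ ωc := fun P hP =>
    (le_csSup (bddAbove_bellValue_almostQuantumSet B) ⟨P, hP, rfl⟩).trans (not_lt.1 hle)
  exact hfacet.nontrivial (hfacet.facet.noSignalling h₀ fun P hP =>
    bellValue_le_of_slack_mul_slack (fun δ => sub_nonneg.2 (hfacet.facet.valid _
      (deterministicBox_mem_classicalPolytope δ))) δ₀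
      (fun v w h => slack_mul_slack hQ h₀ (hfacet.facet.exists_combination h₀) h) hP)
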